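/- All logarithms are to base $2$ and positions are counted from $0$. For a word $w$, $w[i,j]$ is the subword at positions $i,\dots,j$; $d_H$ is Hamming distance and $w_H$ is Hamming weight. A sequence $S$ of length $N$ is an $(n,d)$-*robust positioning sequence* (RPS) if any two subwords of $S$ of length $n$ that start at different positions have Hamming distance at least $d$; it is an $(n,d)$-*modular* RPS (MRPS) if this holds for any two different positions that are congruent modulo $n$. The *redundancy* of a binary sequence of length $N$ and strength $n$ is $n-\log N$. A vector $u\in\{0,1\}^{\ell}$ is $d$-*auto-cyclic* if $d_H(u,0^iu[0,\ell-i-1])\ge d$ for $1\le i\le d$. For $0<d<k<N$, a vector $v\in\{0,1\}^N$ is $(d,k)$-*WWL* if every subword of $v$ of length $k$ has weight at least $d$. Let $d\ge 1$ and $\ell=d\lceil\log d\rceil+2d$. **(1)** Let $n,k$ satisfy $\ell<k$ and $k+\ell<n$, and put $n'=n-k-\ell$. Let $u\in\{0,1\}^{\ell}$ be a $d$-auto-cyclic vector that begins and ends with $1^d$, let $p=0^ku$, and let $s_0,\dots,s_{M-1}\in\{0,1\}^{n'}$ be such that - every $s_i$ is a $(d,k)$-WWL vector; - $s_{i+1}[0,j-1]\,s_i[j,n'-1]$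 is a $(d,k)$-WWL vector for all $0\le i\le M-2$ and $0\le j\le n'-2$; - $s_0s_1\cdots s_{M-1}$ is an $(n',d)$-MRPS. Then $S=p s_0\,p s_1\cdots p s_{M-1}$ is an $(n,d)$-RPS. **(2)** Let $u=1^du_0u_1\cdots u_{\lceil\log d\rceil}$, where $u_i$ is the prefix of length $d$ of $(1^{2^i}0^{2^i})^d$; it has length $\ell$. Let $m,k,n_R,k_R$ be nonnegative integers with $m\ge1$, $n_R=k_R+2d+2$ and $n=k+\ell+m\,n_R+(2d+2)d$. Choose a bijection $\phi$ from the field $\mathbb F_q$, $q=2^m$, onto $\{0,1\}^m$, distinct points $a_0,\dots,a_{n_R-1}\in\mathbb F_q$, and a Gray code $\sigma_0,\dots,\sigma_{M-1}$ over $X=\{a\in\mathbb F_q: w_H(\phi(a))\ge d\}$, i.e. a list of all words of $X^{k_R}$, each occurring once, in which consecutive words differ in exactly one position; here $M=r^{k_R}$ with $r=|X|=\sum_{i=d}^m\binom mi$. Let $c_i=(f_i(a_0),\dots,f_i(a_{n_R-1}))$ be the Reed–Solomon codeword with prefix $\sigma_i$, where $f_i$ is the polynomial of degree less than $k_R$ with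 $f_i(a_j)=\sigma_i[j]$ for $0\le j<k_R$. Put $$s_i=\phi(c_i[0])\cdots\phi(c_i[k_R-1])\,1^d\phi(c_i[k_R])\,1^d\phi(c_i[k_R+1])\cdots 1^d\phi(c_i[n_R-1]),\qquad S=p s_0\,p s_1\cdots p s_{M-1},\quad p=0^ku.$$ There are a real number $C$ and an integer $n_0$, depending only on $d$, such that for every $n\ge n_0$: - (a) there are integers $m,k$ with $3m\le k<4m$ for which the construction can be carried out, and for these $m,k$ every sequence $S$ it produces is a binary $(n,d)$-RPS with redundancy at most $3d\log n+6.5\log n+C$; - (b) for $m=\lceil\frac32\log n\rceil$ and $k=3m$: the construction can be carried out whenever $m$ divides $n-\ell-(2d+2)d$, and every sequence $S$ that it produces for these $m,k$ is a binary $(n,d)$-RPS with redundancy at most $3d\log n+6.5\log n+C$. -/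

import Mathlib

/-- The length-`n` contiguous subword `S[i, i+n-1]` of a sequence `S` (positions start at `0`). -/
def window {α : Type*} (S : List α) (i n : ℕ) : List α :=
  (S.drop i).take n

/-- The Hamming distance of two words of the same length. -/
def wordDist {α : Type*} [DecidableEq α] (v w : List α) : ℕ :=
  ((Finset.range (max v.length w.length)).filter (fun t => v[t]? ≠ w[t]?)).card

/-- The Hamming weight of a binary word. -/
def wordWeight (v : List Bool) : ℕ :=
  v.count true

/-- `S` is a robust positioning sequence of strength `n` and distance `d`: any two subwords of
length `n` of `S` at different positions have Hamming distance at least `d`. -/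
def IsRPS {α : Type*} [DecidableEq α] (n d : ℕ) (S : List α) : Prop :=
  ∀ i j : ℕ, i < j → j + n ≤ S.length → d ≤ wordDist (window S i n) (window S j n)

/-- `S` is a modular robust positioning sequence of strength `n` and distance `d`: the same
condition, only for positions that are congruent modulo `n`. -/
def IsMRPS {α : Type*} [DecidableEq α] (n d : ℕ) (S : List α) : Prop :=
  ∀ i j : ℕ, i < j → i ≡ j [MOD n] → j + n ≤ S.length →
    d ≤ wordDist (window S i n) (window S j n)

/-- The redundancy `n - log₂ N` of a binary sequence of length `N` regarded with strength `n`. -/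
noncomputable def redundancy (n : ℕ) (S : List Bool) : ℝ :=
  (n : ℝ) - Real.logb 2 (S.length : ℝ)

/-- `u` is `d`-auto-cyclic: `d_H(u, 0^i u[0, ℓ-i-1]) ≥ d` for `1 ≤ i ≤ d`, where `ℓ = |u|`. -/
def IsAutoCyclic (d : ℕ) (u : List Bool) : Prop :=
  ∀ i : ℕ, 1 ≤ i → i ≤ d →
    d ≤ wordDist u (List.replicate i false ++ u.take (u.length - i))

/-- The length `ℓ = d ⌈log₂ d⌉ + 2 d` of the auto-cyclic part of the marker. -/
def autoCyclicLength (d : ℕ) : ℕ :=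
  d * Nat.clog 2 d + 2 * d

/-- The vector `1^d u_0 ⋯ u_{⌈log₂ d⌉}`, where `u_i` is the prefix of length `d` of
`(1^{2^i} 0^{2^i})^d`. -/
def autoCyclicVector (d : ℕ) : List Bool :=
  List.replicate d true ++
    ((List.range (Nat.clog 2 d + 1)).map (fun i =>
      ((List.replicate d
        (List.replicate (2 ^ i) true ++ List.replicate (2 ^ i) false)).flatten).take d)).flatten

/-- `v` is a `(d, k)`-window weight limited vector: `0 < d < k < |v|`, and every subword of
length `k` of `v` has Hamming weight at least `d`. -/
def IsWWL (d k : ℕ) (v : List Bool) : Prop :=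
  0 < d ∧ d < k ∧ k < v.length ∧
    ∀ i : ℕ, i + k ≤ v.length → d ≤ wordWeight (window v i k)

/-- The marker `0^k u`. -/
def marker (k : ℕ) (u : List Bool) : List Bool :=
  List.replicate k false ++ u

/-- The sequence `p s_0 p s_1 ⋯ p s_{M-1}`. -/
def markedConcat {M : ℕ} (p : List Bool) (s : Fin M → List Bool) : List Bool :=
  (List.ofFn (fun i => p ++ s i)).flatten

/-- The conditions on the words `s_0, …, s_{M-1}` of length `n'`: each of them is a
`(d, k)`-WWL vector, so is every mixed word `s_{i+1}[0, j-1] s_i[j, n'-1]`, and the concatenation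
`s_0 ⋯ s_{M-1}` is an `(n', d)`-MRPS. -/
structure IsAdmissibleFamily (d k n' : ℕ) {M : ℕ} (s : Fin M → List Bool) : Prop where
  length_eq : ∀ i, (s i).length = n'
  wwl : ∀ i, IsWWL d k (s i)
  wwl_mixed : ∀ (i : ℕ) (hi : i + 1 < M) (j : ℕ), j < n' - 1 →
    IsWWL d k ((s ⟨i + 1, hi⟩).take j ++ (s ⟨i, Nat.lt_of_succ_lt hi⟩).drop j)
  mrps : IsMRPS n' d (List.ofFn s).flatten

/-- `σ_0, …, σ_{N-1}` is a Gray code: it lists every word of `A^κ` exactly once, and any two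
consecutive words differ in exactly one position. -/
structure IsGrayCode {A : Type*} {κ N : ℕ} (σ : Fin N → Fin κ → A) : Prop where
  bijective : Function.Bijective σ
  adjacent : ∀ (i : ℕ) (hi : i + 1 < N),
    ∃! t : Fin κ, σ ⟨i, Nat.lt_of_succ_lt hi⟩ t ≠ σ ⟨i + 1, hi⟩ t

/-- Systematic encoder of the Reed–Solomon code of length `nR` and dimension `kR` with evaluation
points `pts`: the word `σ` is sent to the values at the points `pts 0, …, pts (nR - 1)` of the
polynomial of degree less than `kR` whose value at `pts j` is `σ j` for every `j < kR`. -/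
noncomputable def rsEncode {F : Type*} [Field F] {nR kR : ℕ} (h : kR ≤ nR) (pts : Fin nR ↪ F)
    (σ : Fin kR → F) : Fin nR → F :=
  fun j => (Lagrange.interpolate Finset.univ (fun i : Fin kR => pts (Fin.castLE h i)) σ).eval
    (pts j)

/-- The number `r` of binary words of length `m` and Hamming weight at least `d`. -/
def heavyCount (d m : ℕ) : ℕ :=
  ∑ i ∈ Finset.Icc d m, m.choose i

/-- The choices that go into the explicit sequence of strength `n` for the distance `d`, with
symbols of `m` bits and a marker that starts with `k` zeros: lengths `nR`, `kR` that fit, a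
bijection `φ` from the field with `2^m` elements to the binary words of length `m`, distinct
evaluation points, and a Gray code over the set of the field elements `a` such that
`φ a` has Hamming weight at least `d`. -/
structure GrayRSData (d n m k : ℕ) where
  m_pos : 0 < m
  nR : ℕ
  kR : ℕ
  nR_eq : nR = kR + (2 * d + 2)
  n_eq : n = (k + autoCyclicLength d) + (m * nR + (2 * d + 2) * d)
  φ : GaloisField 2 m ≃ (Fin m → Bool)
  pts : Fin nR ↪ GaloisField 2 m
  gray : Fin (heavyCount d m ^ kR) → Fin kR →
    {a : GaloisField 2 m // d ≤ wordWeight (List.ofFn (φ a))}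
  isGrayCode : IsGrayCode gray

namespace GrayRSData

variable {d n m k : ℕ} (D : GrayRSData d n m k)

/-- The Reed–Solomon codeword `c_i` whose prefix is the `i`-th word of the Gray code. -/
noncomputable def codeword (i : Fin (heavyCount d m ^ D.kR)) : Fin D.nR → GaloisField 2 m :=
  rsEncode (D.nR_eq ▸ Nat.le_add_right _ _) D.pts (fun t => (D.gray i t : GaloisField 2 m))

/-- The binary word
`s_i = φ(c_i[0]) ⋯ φ(c_i[kR-1]) 1^d φ(c_i[kR]) 1^d φ(c_i[kR+1]) ⋯ 1^d φ(c_i[nR-1])`. -/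
noncomputable def word (i : Fin (heavyCount d m ^ D.kR)) : List Bool :=
  (List.ofFn (fun j : Fin D.nR =>
    (if D.kR ≤ (j : ℕ) then List.replicate d true else []) ++
      List.ofFn (D.φ (D.codeword i j)))).flatten

/-- The sequence `p s_0 p s_1 ⋯ p s_{M-1}` with the marker `p = 0^k u`, `u` the explicit
auto-cyclic vector. -/
noncomputable def seq : List Bool :=
  markedConcat (marker k (autoCyclicVector d)) D.word

end GrayRSData

/-! Part (1). A window of length `n` meets every residue class modulo `n` exactly once. Read by
residues it is an `n`-periodic word: `0^k u` on the residues below `k + ℓ`, then a mixture of two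
consecutive `s_i`. Two windows whose starts differ by `δ` compare `A c` with `B (c + δ)`. If `n ∣
δ`, the markers align, and what remains is a pair of windows of `s_0 s_1 ⋯` at positions congruent
modulo `n'`, so the MRPS hypothesis applies. Otherwise, exchanging the two words if necessary, `0 <
δ < n - k`, and one marker yields `d` mismatches (`IsMarkedWord.le_card_of_lt`): `0^k u` meets a
short shift of itself, or `0^k` meets an end `1^d` of `u` or a window of weight at least `d`.

Part (2). The explicit `u` is auto-cyclic because the block of period `2^(h+1)` detects the shifts
`2^h · odd`. A window of length `3m` of a mixed word contains an uncut heavy symbol or a complete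
`1^d` (`le_card_mixed_symbolWord`). For the MRPS property, distinct codewords differ in at least `2d
+ 3` symbols. A mixture of consecutive codewords is compared with the older or the newer of the two,
according to where the cut lies; the Gray code makes the prefix cost only two symbols
(`le_card_mixed_symbols`).

The redundancy is `k + (2d+2)m - log n + O(1)` once `kR (m - log r) ≤ 1`. This holds for large `n`
when `m ≥ (5/4) log n`, since `m - log r = O(m^d / 2^m)` while `kR ≤ n ≤ 2^(4m/5)`. -/

section

open Finset Filter

/-! ### Counting positions -/

lemma card_filter_range_le_of_offset {P Q : ℕ → Prop} [DecidablePred P] [DecidablePred Q]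
    {a L n : ℕ} (h : a + L ≤ n) (hPQ : ∀ t < L, Q t → P (a + t)) :
    #{t ∈ range L | Q t} ≤ #{c ∈ range n | P c} := by
  refine card_le_card_of_injOn (fun t => a + t) ?_ (fun x _ y _ hxy => by simpa using hxy)
  intro t ht
  simp only [coe_filter, Finset.mem_range, Set.mem_ofPred_eq] at ht ⊢
  exact ⟨by omega, hPQ t ht.1 ht.2⟩

lemma le_card_filter_range {P : ℕ → Prop} [DecidablePred P] {a d n : ℕ} (h : a + d ≤ n)
    (hP : ∀ t < d, P (a + t)) : d ≤ #{c ∈ range n | P c} := by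
  have := card_filter_range_le_of_offset (Q := fun _ => True) h (fun t ht _ => hP t ht)
  simpa using this

lemma card_filter_range_add (P : ℕ → Prop) [DecidablePred P] (a n : ℕ) :
    #{t ∈ range n | P (a + t)} = #{x ∈ Finset.Ico a (a + n) | P x} := by
  rw [card_filter, card_filter, sum_Ico_eq_sum_range]
  simp

lemma Function.Periodic.card_filter_range_add {P : ℕ → Prop} [DecidablePred P] {n : ℕ}
    (hP : Function.Periodic P n) (a : ℕ) :
    #{t ∈ range n | P (a + t)} = #{x ∈ range n | P x} := by
  rw [_root_.card_filter_range_add, Nat.filter_Ico_card_eq_of_periodic _ _ _ hP,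
    Nat.count_eq_card_filter_range]

/-! ### Windows -/

lemma getElem?_window {α : Type*} (S : List α) (i n t : ℕ) :
    (window S i n)[t]? = if t < n then S[i + t]? else none := by
  simp [window, List.getElem?_take, List.getElem?_drop]

lemma length_window {α : Type*} {S : List α} {i n : ℕ} (h : i + n ≤ S.length) :
    (window S i n).length = n := by
  simp [window]; omega

lemma wordDist_eq_card {α : Type*} [DecidableEq α] {v w : List α} {n : ℕ} (hv : v.length = n)
    (hw : w.length = n) : wordDist v w = #{t ∈ range n | v[t]? ≠ w[t]?} := by
  rw [wordDist, hv, hw, max_self]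

lemma wordDist_window {α : Type*} [DecidableEq α] {S : List α} {i j n : ℕ}
    (hi : i + n ≤ S.length) (hj : j + n ≤ S.length) :
    wordDist (window S i n) (window S j n) = #{t ∈ range n | S[i + t]? ≠ S[j + t]?} := by
  rw [wordDist_eq_card (length_window hi) (length_window hj)]
  congr 1
  refine filter_congr fun t ht => ?_
  rw [Finset.mem_range] at ht
  simp [getElem?_window, ht]

lemma wordWeight_eq_card (v : List Bool) :
    wordWeight v = #{t ∈ range v.length | v[t]? = some true} := by
  induction v with
  | nil => simp [wordWeight]
  | cons b v ih =>
    rw [wordWeight, List.count_cons, card_filter, List.length_cons, sum_range_succ', ← wordWeight,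
      ih, card_filter]
    simp

lemma wordWeight_window {S : List Bool} {i k : ℕ} (h : i + k ≤ S.length) :
    wordWeight (window S i k) = #{t ∈ range k | S[i + t]? = some true} := by
  rw [wordWeight_eq_card, length_window h]
  congr 1
  refine filter_congr fun t ht => ?_
  rw [Finset.mem_range] at ht
  simp [getElem?_window, ht]

/-- The position in `[i, i + n)` that is congruent to `x` modulo `n`. -/
def cyclicPos (n i x : ℕ) : ℕ := i + (x + (n - i % n)) % n

lemma cyclicPos_add (n i t : ℕ) (ht : t < n) : cyclicPos n i (i + t) = i + t := by
  have h1 := Nat.mod_lt i (by omega : 0 < n)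
  have h2 := Nat.div_add_mod i n
  have : i + t + (n - i % n) = t + n * (i / n + 1) := by
    rw [mul_add]; omega
  rw [cyclicPos, this, Nat.add_mul_mod_self_left, Nat.mod_eq_of_lt ht]

lemma cyclicPos_add_period (n i x : ℕ) : cyclicPos n i (x + n) = cyclicPos n i x := by
  rw [cyclicPos, cyclicPos, add_right_comm, Nat.add_mod_right]

lemma cyclicPos_congr {n i x y : ℕ} (h : x ≡ y [MOD n]) : cyclicPos n i x = cyclicPos n i y := by
  rw [cyclicPos, cyclicPos]
  congr 1
  exact Nat.ModEq.add_right _ h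

lemma cyclicPos_of_lt (n a r c : ℕ) (hr : r < n) (hc : c < n) :
    cyclicPos n (a * n + r) c = (if c < r then a + 1 else a) * n + c := by
  rw [cyclicPos, Nat.mul_add_mod_of_lt hr]
  split_ifs with h
  · rw [Nat.mod_eq_of_lt (by omega), add_mul]; omega
  · have : c + (n - r) = c - r + n := by omega
    rw [this, Nat.add_mod_right, Nat.mod_eq_of_lt (by omega)]; omega

/-- The mismatch predicate is `n`-periodic in `c`, so counting it over `[i, i + n)` is the same as
counting over all residues. This puts the markers of both windows at fixed places. -/
lemma wordDist_window_cyclicPos {α : Type*} [DecidableEq α] {S : List α} {i j n : ℕ}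
    (hij : i ≤ j) (hj : j + n ≤ S.length) :
    wordDist (window S i n) (window S j n) =
      #{c ∈ range n | S[cyclicPos n i c]? ≠ S[cyclicPos n j (c + (j - i))]?} := by
  rw [wordDist_window (by omega) hj]
  have hP : Function.Periodic
      (fun c => S[cyclicPos n i c]? ≠ S[cyclicPos n j (c + (j - i))]?) n := by
    intro c
    beta_reduce
    rw [cyclicPos_add_period, add_right_comm, cyclicPos_add_period]
  rw [← hP.card_filter_range_add i]
  congr 1
  refine filter_congr fun t ht => ?_
  rw [Finset.mem_range] at ht
  rw [cyclicPos_add _ _ _ ht, show i + t + (j - i) = j + t by omega, cyclicPos_add _ _ _ ht]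

/-! ### Concatenations -/

lemma getElem?_flatten_add {α : Type*} (L : List (List α)) (j t : ℕ) (hj : j < L.length)
    (ht : t < L[j].length) :
    L.flatten[((L.map List.length).take j).sum + t]? = L[j][t]? := by
  rw [← List.getElem?_drop, List.drop_sum_flatten, List.drop_eq_getElem_cons hj,
    List.flatten_cons, List.getElem?_append_left ht]

lemma sum_take_map_length_ofFn {α : Type*} {M n : ℕ} (f : Fin M → List α)
    (hf : ∀ i, (f i).length = n) (j : ℕ) (hj : j ≤ M) :
    (((List.ofFn f).map List.length).take j).sum = j * n := by
  have : (List.ofFn f).map List.length = List.replicate M n := by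
    rw [List.map_ofFn]
    simp [Function.comp_def, hf]
  rw [this, List.take_replicate, min_eq_left hj]
  simp

lemma length_flatten_ofFn {α : Type*} {M n : ℕ} (f : Fin M → List α)
    (hf : ∀ i, (f i).length = n) : (List.ofFn f).flatten.length = M * n := by
  rw [List.length_flatten, ← sum_take_map_length_ofFn f hf M le_rfl, List.take_of_length_le]
  simp

lemma getElem?_flatten_ofFn {α : Type*} {M n : ℕ} (f : Fin M → List α)
    (hf : ∀ i, (f i).length = n) (q r : ℕ) (hq : q < M) (hr : r < n) :
    (List.ofFn f).flatten[q * n + r]? = (f ⟨q, hq⟩)[r]? := by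
  rw [← sum_take_map_length_ofFn f hf q hq.le, getElem?_flatten_add _ _ _ (by simpa) (by simp [hf, hr])]
  simp

/-! ### Marked sequences -/

/-- An `n`-periodic word whose period starts with the marker `0^k u` and whose later subwords of
length `k`, up to one symbol at the end of the period, have weight at least `d`. -/
structure IsMarkedWord (n d k : ℕ) (u : List Bool) (A : ℕ → Option Bool) : Prop where
  periodic : Function.Periodic A n
  zeros : ∀ c < k, A c = some false
  marker : ∀ c < u.length, A (k + c) = u[c]?
  heavy : ∀ e, k + u.length ≤ e → e + k < n → d ≤ #{t ∈ range k | A (e + t) = some true}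

lemma card_filter_range_succ_le {P : ℕ → Prop} [DecidablePred P] {e k : ℕ} (he : P e) :
    #{t ∈ range k | P (e + 1 + t)} ≤ #{t ∈ range k | P (e + t)} := by
  have h1 := sum_range_succ (fun t => if P (e + t) then 1 else 0) k
  have h2 := sum_range_succ' (fun t => if P (e + t) then 1 else 0) k
  rw [h1] at h2
  simp only [card_filter]
  simp only [add_zero, he, if_true, add_assoc, add_comm 1] at h2 ⊢
  split_ifs at h2 <;> omega

/-- Extends `heavy` to windows starting in the final `1^d` of `u`: sliding such a window one step to
the right drops a one, so its weight cannot grow, and the bound travels back from the window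
starting just after `u`. -/
lemma IsMarkedWord.heavy_of_sub_le {n d k : ℕ} {u : List Bool} {A : ℕ → Option Bool}
    (hA : IsMarkedWord n d k u A) (hu : ∀ t < d, u[u.length - d + t]? = some true)
    (hdu : d ≤ u.length) (hn : 2 * k + u.length < n) (e : ℕ) (he : k + u.length - d ≤ e)
    (hen : e + k < n) :
    d ≤ #{t ∈ range k | A (e + t) = some true} := by
  rcases le_or_gt (k + u.length) e with h | h
  · exact hA.heavy e h hen
  obtain ⟨f, hf⟩ : ∃ f, k + u.length = e + f := ⟨k + u.length - e, by omega⟩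
  induction f generalizing e with
  | zero => omega
  | succ f ih =>
    have hAe : A e = some true := by
      have h1 := hA.marker (e - k) (by omega)
      rw [show k + (e - k) = e by omega,
        show e - k = u.length - d + (e - (k + u.length - d)) by omega] at h1
      rw [h1]
      exact hu _ (by omega)
    refine le_trans ?_ (card_filter_range_succ_le (P := fun x => A x = some true) hAe)
    rcases Nat.eq_zero_or_pos f with rfl | hfpos
    · exact hA.heavy (e + 1) (by omega) (by omega)
    · exact ih (e + 1) (by omega) (by omega) (by omega) (by omega)

lemma IsAutoCyclic.le_card {d : ℕ} {u : List Bool} (hu : IsAutoCyclic d u) {i : ℕ} (hi : 1 ≤ i)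
    (hid : i ≤ d) (hdu : d ≤ u.length) :
    d ≤ #{t ∈ range u.length | u[t]? ≠ if t < i then some false else u[t - i]?} := by
  refine (hu i hi hid).trans_eq ?_
  rw [wordDist_eq_card (n := u.length) rfl (by simp; omega)]
  congr 1
  refine filter_congr fun t ht => ?_
  rw [Finset.mem_range] at ht
  rw [List.getElem?_append, List.length_replicate]
  split_ifs with h
  · simp [h]
  · rw [List.getElem?_take, if_pos (by omega)]

lemma IsMarkedWord.le_card_of_lt {n d k : ℕ} {u : List Bool} {A B : ℕ → Option Bool}
    (hA : IsMarkedWord n d k u A) (hB : IsMarkedWord n d k u B) (hac : IsAutoCyclic d u)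
    (hpre : ∀ t < d, u[t]? = some true) (hsuf : ∀ t < d, u[u.length - d + t]? = some true)
    (hdu : 2 * d ≤ u.length) (huk : u.length < k) (hn : 2 * k + u.length < n) {δ : ℕ}
    (hδ : 0 < δ) (hδn : δ + k < n) :
    d ≤ #{c ∈ range n | A (c + δ) ≠ B c} := by
  -- Small shift: `u` faces `0^δ u[0, ℓ-δ-1]`, where the zeros are the end of `0^k`.
  rcases le_or_gt δ d with h1 | h1
  · refine (hac.le_card hδ h1 (by omega)).trans ?_
    refine card_filter_range_le_of_offset (a := k - δ) (by omega) fun t ht hne => ?_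
    rw [show k - δ + t + δ = k + t by omega, hA.marker t ht]
    convert hne using 1
    split_ifs with h
    · rw [hB.zeros _ (by omega)]
    · rw [← hB.marker _ (by omega), show k - δ + t = k + (t - δ) by omega]
  -- The prefix `1^d` of `u` lies entirely opposite the zeros of `B`, because `d < δ ≤ k`.
  rcases le_or_gt δ k with h2 | h2
  · refine le_card_filter_range (a := k - δ) (by omega) fun t ht => ?_
    rw [show k - δ + t + δ = k + t by omega, hA.marker t (by omega), hpre t ht,
      hB.zeros _ (by omega)]
    simp
  -- Now the suffix `1^d` of `u` falls on the zeros of `B`, because `ℓ < k < δ`; for still larger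
  -- `δ` the whole run `0^k` of `B` faces a heavy window of `A`.
  rcases le_or_gt δ (k + u.length - d) with h3 | h3
  · refine le_card_filter_range (a := k + u.length - d - δ) (by omega) fun t ht => ?_
    rw [show k + u.length - d - δ + t + δ = k + (u.length - d + t) by omega,
      hA.marker _ (by omega), hsuf t ht, hB.zeros _ (by omega)]
    simp
  · refine (hA.heavy_of_sub_le hsuf (by omega) hn δ h3.le hδn).trans ?_
    refine card_filter_range_le_of_offset (a := 0) (by omega) fun t ht hne => ?_
    rw [zero_add, add_comm t δ, hne, hB.zeros t ht]
    simp

lemma IsMarkedWord.le_card {n d k : ℕ} {u : List Bool} {A B : ℕ → Option Bool}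
    (hA : IsMarkedWord n d k u A) (hB : IsMarkedWord n d k u B) (hac : IsAutoCyclic d u)
    (hpre : ∀ t < d, u[t]? = some true) (hsuf : ∀ t < d, u[u.length - d + t]? = some true)
    (hdu : 2 * d ≤ u.length) (huk : u.length < k) (hn : 2 * k + u.length < n) {δ : ℕ}
    (hδ : ¬ δ ≡ 0 [MOD n]) :
    d ≤ #{c ∈ range n | A c ≠ B (c + δ)} := by
  have hpos : 0 < δ % n := Nat.pos_of_ne_zero fun h => hδ (by simpa [Nat.ModEq] using h)
  have hlt : δ % n < n := Nat.mod_lt _ (by omega)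
  have hBδ : ∀ c, B (c + δ) = B (c + δ % n) := fun c => by
    conv_lhs => rw [← Nat.mod_add_div δ n, ← add_assoc, mul_comm]
    exact hB.periodic.nat_mul _ _
  simp only [hBδ]
  rcases lt_or_ge (δ % n + k) n with h | h
  · refine (hB.le_card_of_lt hA hac hpre hsuf hdu huk hn hpos h).trans_eq ?_
    congr 1
    exact filter_congr fun c _ => ne_comm
  -- A shift of at least `n - k` is a shift by `n - δ % n ≤ k` with the two words exchanged.
  · refine (hA.le_card_of_lt hB hac hpre hsuf hdu huk hn (δ := n - δ % n) (by omega)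
      (by omega)).trans_eq ?_
    have hP : Function.Periodic (fun c => A (c + (n - δ % n)) ≠ B c) n := by
      intro c
      beta_reduce
      rw [hB.periodic c, add_right_comm, hA.periodic]
    rw [← hP.card_filter_range_add (δ % n)]
    congr 1
    refine filter_congr fun c _ => ?_
    rw [show δ % n + c + (n - δ % n) = c + n by omega, hA.periodic, add_comm c]

/-- The word `s_{a+1}[0, r-1] s_a[r, n'-1]`, or `s_a` if `r = 0`. -/
def mixedGet {M : ℕ} (s : Fin M → List Bool) (a r c : ℕ) : Option Bool :=
  (List.ofFn s)[if c < r then a + 1 else a]?.bind (·[c]?)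

lemma mixedGet_eq {M : ℕ} (s : Fin M → List Bool) (a r c : ℕ) (ha : a < M)
    (ha' : c < r → a + 1 < M) : mixedGet s a r c =
      if h : c < r then (s ⟨a + 1, ha' h⟩)[c]? else (s ⟨a, ha⟩)[c]? := by
  rw [mixedGet]
  split_ifs with h
  · simp [ha' h]
  · simp [ha]

lemma getElem?_flatten_cyclicPos {M n : ℕ} (s : Fin M → List Bool)
    (hs : ∀ i, (s i).length = n) (a r c : ℕ) (hr : r < n) (h : a * n + r + n ≤ M * n)
    (hc : c < n) :
    (List.ofFn s).flatten[cyclicPos n (a * n + r) c]? = mixedGet s a r c := by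
  have ha : a < M := by
    by_contra hcon
    have := Nat.mul_le_mul_right n (not_lt.mp hcon)
    omega
  have ha' : c < r → a + 1 < M := by
    intro hcr
    by_contra hcon
    have := Nat.mul_le_mul_right n (not_lt.mp hcon)
    rw [add_mul] at this
    omega
  rw [cyclicPos_of_lt _ _ _ _ hr hc, mixedGet_eq s a r c ha ha']
  split_ifs with hcr
  · rw [getElem?_flatten_ofFn s hs _ _ (ha' hcr) hc]
  · rw [getElem?_flatten_ofFn s hs _ _ ha hc]

lemma lt_of_add_le_mul {a n r M : ℕ} (hn : 0 < n) (h : a * n + r + n ≤ M * n) :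
    a < M ∧ (0 < r → a + 1 < M) := by
  constructor
  · by_contra hcon
    have := Nat.mul_le_mul_right n (not_lt.mp hcon)
    omega
  · intro hr
    by_contra hcon
    have := Nat.mul_le_mul_right n (not_lt.mp hcon)
    rw [add_mul] at this
    omega

lemma IsAdmissibleFamily.heavy {d k n' M : ℕ} {s : Fin M → List Bool}
    (hs : IsAdmissibleFamily d k n' s) {a r e : ℕ} (ha : a < M) (har : 0 < r → a + 1 < M)
    (hr : r < n') (he : e + k < n') :
    d ≤ #{t ∈ range k | mixedGet s a r (e + t) = some true} := by
  have key : ∀ v : List Bool, v.length = n' → IsWWL d k v →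
      (∀ t < k, mixedGet s a r (e + t) = v[e + t]?) →
      d ≤ #{t ∈ range k | mixedGet s a r (e + t) = some true} := by
    intro v hv hw hvs
    refine (hw.2.2.2 e (by omega)).trans_eq ?_
    rw [wordWeight_window (by omega)]
    congr 1
    refine filter_congr fun t ht => ?_
    rw [hvs t (Finset.mem_range.mp ht)]
  rcases Nat.eq_zero_or_pos r with rfl | hr0
  · refine key _ (hs.length_eq ⟨a, ha⟩) (hs.wwl _) fun t _ => ?_
    rw [mixedGet_eq s a 0 _ ha (by simp)]
    simp
  -- The hypothesis on mixed words stops at `j = n' - 2`. For the cut `n' - 1` only the last symbol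
  -- is old, and `e + k < n'` keeps the window away from it, so it is a window of `s_{a+1}`.
  rcases lt_or_ge r (n' - 1) with h | h
  · refine key _ ?_ (hs.wwl_mixed a (har hr0) r h) fun t ht => ?_
    · simp [hs.length_eq]; omega
    · rw [mixedGet_eq s a r _ ha (fun _ => har hr0), List.getElem?_append, List.length_take,
        hs.length_eq, min_eq_left hr.le]
      split_ifs with h
      · rw [List.getElem?_take, if_pos h]
      · rw [List.getElem?_drop]
        congr 1
        omega
  · refine key _ (hs.length_eq ⟨a + 1, har hr0⟩) (hs.wwl _) fun t ht => ?_
    rw [mixedGet_eq s a r _ ha (fun _ => har hr0), dif_pos (by omega)]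

/-- The truncated subtraction is intended: a cut inside the marker leaves `s_a` whole, which is the
cut `0`. -/
lemma mixedGet_marker {M k : ℕ} {u : List Bool} {s : Fin M → List Bool} {a r c : ℕ}
    (ha : a < M) (har : 0 < r → a + 1 < M) (hc : k + u.length ≤ c) :
    mixedGet (fun i => marker k u ++ s i) a r c =
      mixedGet s a (r - (k + u.length)) (c - (k + u.length)) := by
  rw [mixedGet_eq _ a r c ha (fun h => har (by omega)),
    mixedGet_eq s a _ _ ha (fun h => har (by omega))]
  have hl : (marker k u).length = k + u.length := by simp [marker]
  by_cases h : c < r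
  · rw [dif_pos h, dif_pos (by omega), List.getElem?_append_right (by omega), hl]
  · rw [dif_neg h, dif_neg (by omega), List.getElem?_append_right (by omega), hl]

lemma mixedGet_marker_of_lt {M k : ℕ} {u : List Bool} {s : Fin M → List Bool} {a r c : ℕ}
    (ha : a < M) (har : 0 < r → a + 1 < M) (hc : c < k + u.length) :
    mixedGet (fun i => marker k u ++ s i) a r c = (marker k u)[c]? := by
  rw [mixedGet_eq _ a r c ha (fun h => har (by omega))]
  have hl : (marker k u).length = k + u.length := by simp [marker]
  split_ifs <;> rw [List.getElem?_append_left (by omega)]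

theorem isRPS_markedConcat {d n k M : ℕ} {u : List Bool} {s : Fin M → List Bool}
    (hdu : 2 * d ≤ u.length) (huk : u.length < k) (hkn : k + u.length < n)
    (hac : IsAutoCyclic d u) (hpre : ∀ t < d, u[t]? = some true)
    (hsuf : ∀ t < d, u[u.length - d + t]? = some true)
    (hs : IsAdmissibleFamily d k (n - (k + u.length)) s) :
    IsRPS n d (markedConcat (marker k u) s) := by
  have hl : (marker k u).length = k + u.length := by simp [marker]
  obtain ⟨n', rfl⟩ : ∃ n', n = k + u.length + n' := ⟨n - (k + u.length), by omega⟩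
  rw [Nat.add_sub_cancel_left] at hs
  set n := k + u.length + n' with hn
  have hlen : ∀ i, (marker k u ++ s i).length = n := fun i => by
    rw [List.length_append, hl, hs.length_eq]
  intro i j hij hj
  rw [wordDist_window_cyclicPos hij.le hj]
  rw [markedConcat, length_flatten_ofFn _ hlen] at hj
  rw [markedConcat]
  have hn0 : 0 < n := by omega
  obtain ⟨a, r, hr, rfl⟩ : ∃ a r, r < n ∧ i = a * n + r :=
    ⟨i / n, i % n, Nat.mod_lt _ hn0, by rw [mul_comm, Nat.div_add_mod]⟩
  obtain ⟨b, r₂, hr₂, rfl⟩ : ∃ a r, r < n ∧ j = a * n + r :=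
    ⟨j / n, j % n, Nat.mod_lt _ hn0, by rw [mul_comm, Nat.div_add_mod]⟩
  obtain ⟨ha, har⟩ := lt_of_add_le_mul hn0 (show a * n + r + n ≤ M * n by omega)
  obtain ⟨hb, hbr⟩ := lt_of_add_le_mul hn0 hj
  -- The inequality is part of the definition of WWL; it supplies `2 * k + u.length < n`.
  have hkn' : k < n' := by
    have h1 := (hs.wwl ⟨a, ha⟩).2.2.1
    rwa [hs.length_eq] at h1
  by_cases hmod : b * n + r₂ - (a * n + r) ≡ 0 [MOD n]
  · have hrr : r = r₂ := by
      have h1 : a * n + r ≡ b * n + r₂ [MOD n] := by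
        have := Nat.ModEq.add_left (a * n + r) hmod
        rw [Nat.add_sub_cancel' hij.le] at this
        exact this.symm
      rwa [Nat.ModEq, Nat.mul_add_mod_of_lt hr, Nat.mul_add_mod_of_lt hr₂] at h1
    subst hrr
    have hab : a < b := by
      by_contra hcon
      have := Nat.mul_le_mul_right n (not_lt.mp hcon)
      omega
    have hab' : a * n' + n' ≤ b * n' := by
      rw [← Nat.succ_mul]; exact Nat.mul_le_mul_right _ hab
    -- With cut `0` the window uses only `s_b`; otherwise `r > 0`, so `s_{b+1}` exists.
    have hj' : b * n' + (r - (k + u.length)) + n' ≤ M * n' := by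
      rcases Nat.eq_zero_or_pos (r - (k + u.length)) with h0 | h0
      · rw [h0, add_zero, ← Nat.succ_mul]; exact Nat.mul_le_mul_right _ hb
      · have : (b + 1 + 1) * n' ≤ M * n' := Nat.mul_le_mul_right _ (hbr (by omega))
        rw [add_mul, add_mul] at this
        omega
    have hij' : a * n' + (r - (k + u.length)) < b * n' + (r - (k + u.length)) := by omega
    have hm := hs.mrps _ _ hij' (by simp [Nat.ModEq])
      (by rwa [length_flatten_ofFn _ hs.length_eq])
    rw [wordDist_window_cyclicPos hij'.le (by rwa [length_flatten_ofFn _ hs.length_eq])] at hm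
    refine hm.trans (card_filter_range_le_of_offset (a := k + u.length) hn.ge fun t ht hne => ?_)
    rw [cyclicPos_congr (x := k + u.length + t + _) (y := k + u.length + t),
      getElem?_flatten_cyclicPos _ hlen _ _ _ hr (by omega) (by omega),
      getElem?_flatten_cyclicPos _ hlen _ _ _ hr (by omega) (by omega),
      mixedGet_marker ha har (by omega), mixedGet_marker hb hbr (by omega),
      Nat.add_sub_cancel_left]
    · rw [cyclicPos_congr (x := t + _) (y := t),
        getElem?_flatten_cyclicPos _ hs.length_eq _ _ _ (by omega) (by omega) (by omega),
        getElem?_flatten_cyclicPos _ hs.length_eq _ _ _ (by omega) (by omega) (by omega)] at hne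
      · exact hne
      · rw [Nat.add_sub_add_right, ← Nat.sub_mul]
        simp [Nat.ModEq]
    · exact Nat.ModEq.add_left _ hmod
  · have marked : ∀ a r : ℕ, r < n → a < M → (0 < r → a + 1 < M) → a * n + r + n ≤ M * n →
        IsMarkedWord n d k u
          (fun c => (List.ofFn fun i => marker k u ++ s i).flatten[cyclicPos n (a * n + r) c]?) := by
      intro a r hr ha har h
      have hget : ∀ c < n, (List.ofFn fun i => marker k u ++ s i).flatten[
          cyclicPos n (a * n + r) c]? = mixedGet (fun i => marker k u ++ s i) a r c :=
        fun c hc => getElem?_flatten_cyclicPos _ hlen a r c hr h hc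
      refine ⟨fun c => by rw [cyclicPos_add_period], fun c hc => ?_, fun c hc => ?_,
        fun e he hek => ?_⟩
      · rw [hget c (by omega), mixedGet_marker_of_lt ha har (by omega), marker,
          List.getElem?_append_left (by simpa)]
        simp [hc]
      · rw [hget _ (by omega), mixedGet_marker_of_lt ha har (by omega), marker,
          List.getElem?_append_right (by simp)]
        simp
      · refine (hs.heavy (a := a) (r := r - (k + u.length)) (e := e - (k + u.length)) ha
          (fun h => har (by omega)) (by omega) (by omega)).trans_eq ?_
        congr 1
        refine filter_congr fun t ht => ?_
        rw [Finset.mem_range] at ht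
        rw [hget _ (by omega), mixedGet_marker ha har (by omega),
          show e + t - (k + u.length) = e - (k + u.length) + t by omega]
    exact (marked a r hr ha har (by omega)).le_card (marked b r₂ hr₂ hb hbr hj) hac hpre hsuf hdu
      huk (by omega) hmod

theorem isRPS_markedConcat_of_prefix_of_suffix {d n k M : ℕ} {u : List Bool}
    {s : Fin M → List Bool} (hk : autoCyclicLength d < k) (hkn : k + autoCyclicLength d < n)
    (hu : u.length = autoCyclicLength d) (hac : IsAutoCyclic d u)
    (hpre : List.replicate d true <+: u) (hsuf : List.replicate d true <:+ u)
    (hs : IsAdmissibleFamily d k (n - (k + autoCyclicLength d)) s) :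
    IsRPS n d (markedConcat (marker k u) s) := by
  rw [← hu] at hk hkn hs
  refine isRPS_markedConcat (by rw [hu, autoCyclicLength]; omega) hk hkn hac ?_ ?_ hs
  · obtain ⟨v, rfl⟩ := hpre
    intro t ht
    rw [List.getElem?_append_left (by simpa)]
    simp [ht]
  · obtain ⟨v, rfl⟩ := hsuf
    intro t ht
    rw [List.getElem?_append_right (by simp)]
    simp [ht]

/-! ### The explicit auto-cyclic vector -/

lemma getElem?_alternating (i d t : ℕ) (ht : t < d) :
    (((List.replicate d
      (List.replicate (2 ^ i) true ++ List.replicate (2 ^ i) false)).flatten).take d)[t]? =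
      some (decide ((t / 2 ^ i) % 2 = 0)) := by
  have h2 : 0 < 2 ^ i := by positivity
  have hf : ∀ _ : Fin d, (List.replicate (2 ^ i) true ++ List.replicate (2 ^ i) false).length =
      2 ^ i * 2 := fun _ => by simp; ring
  rw [List.getElem?_take, if_pos ht, ← List.ofFn_const]
  have h3 := getElem?_flatten_ofFn _ hf (t / (2 ^ i * 2)) (t % (2 ^ i * 2))
    (lt_of_le_of_lt (Nat.div_le_self _ _) ht) (Nat.mod_lt _ (by positivity))
  rw [mul_comm, Nat.div_add_mod] at h3
  rw [h3, List.getElem?_append, List.length_replicate, Nat.mod_mul]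
  have h4 := Nat.mod_lt t h2
  rcases Nat.mod_two_eq_zero_or_one (t / 2 ^ i) with h | h
  · rw [h, mul_zero, add_zero, if_pos h4]
    simp [h4]
  · rw [h, mul_one, if_neg (by omega), Nat.add_sub_cancel]
    simp [h4]

lemma length_alternating (i d : ℕ) :
    (((List.replicate d
      (List.replicate (2 ^ i) true ++ List.replicate (2 ^ i) false)).flatten).take d).length =
      d := by
  have h2 : 0 < 2 ^ i := by positivity
  simp
  nlinarith

lemma autoCyclicVector_eq (d : ℕ) : autoCyclicVector d = List.replicate d true ++
    (List.ofFn fun i : Fin (Nat.clog 2 d + 1) =>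
      ((List.replicate d
        (List.replicate (2 ^ (i : ℕ)) true ++ List.replicate (2 ^ (i : ℕ)) false)).flatten).take
          d).flatten := by
  rw [autoCyclicVector, List.ofFn_eq_map, ← List.map_coe_finRange_eq_range, List.map_map]
  rfl

lemma length_autoCyclicVector (d : ℕ) : (autoCyclicVector d).length = autoCyclicLength d := by
  rw [autoCyclicVector_eq, List.length_append, List.length_replicate,
    length_flatten_ofFn _ (fun i => length_alternating _ _), autoCyclicLength]
  ring

lemma getElem?_autoCyclicVector_of_lt {d t : ℕ} (ht : t < d) :
    (autoCyclicVector d)[t]? = some true := by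
  rw [autoCyclicVector, List.getElem?_append_left (by simpa)]
  simp [ht]

lemma getElem?_autoCyclicVector {d h t : ℕ} (hh : h ≤ Nat.clog 2 d) (ht : t < d) :
    (autoCyclicVector d)[d + h * d + t]? = some (decide ((t / 2 ^ h) % 2 = 0)) := by
  rw [autoCyclicVector_eq, List.getElem?_append_right (by simp; omega), List.length_replicate,
    add_assoc, Nat.add_sub_cancel_left, getElem?_flatten_ofFn _ (fun i => length_alternating _ _)
    _ _ (Nat.lt_succ_of_le hh) ht, getElem?_alternating _ _ _ ht]

lemma replicate_prefix_autoCyclicVector (d : ℕ) :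
    List.replicate d true <+: autoCyclicVector d := ⟨_, rfl⟩

/-- The last block has run length `2 ^ clog d ≥ d`, so its prefix of length `d` consists of ones. -/
lemma replicate_suffix_autoCyclicVector (d : ℕ) :
    List.replicate d true <:+ autoCyclicVector d := by
  have hl := length_autoCyclicVector d
  rw [autoCyclicLength] at hl
  have : List.replicate d true = (autoCyclicVector d).drop (d + Nat.clog 2 d * d) := by
    refine List.ext_getElem? fun t => ?_
    rw [List.getElem?_drop]
    rcases lt_or_ge t d with ht | ht
    · rw [getElem?_autoCyclicVector le_rfl ht, Nat.div_eq_of_lt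
        (ht.trans_le (Nat.le_pow_clog (by norm_num) d))]
      simp [ht]
    · rw [List.getElem?_eq_none (by simpa), List.getElem?_eq_none]
      rw [hl, mul_comm]
      omega
  rw [this]
  exact List.drop_suffix _ _

/-- Write the shift as `i = 2^h * o` with `o` odd. The leading ones against the padding zeros give
`i` mismatches. In the block `u_h`, moving by `i` changes `⌊x / 2^h⌋` by the odd number `o`, so all
`d - i` pairs inside the block differ. -/
lemma isAutoCyclic_autoCyclicVector (d : ℕ) : IsAutoCyclic d (autoCyclicVector d) := by
  intro i hi hid
  set u := autoCyclicVector d with hu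
  have hl : u.length = autoCyclicLength d := length_autoCyclicVector d
  rw [wordDist_eq_card (n := u.length) rfl (by
    rw [List.length_append, List.length_replicate, List.length_take]
    rw [autoCyclicLength] at hl; omega)]
  obtain ⟨h, o, ho, rfl⟩ := Nat.exists_eq_two_pow_mul_odd (by omega : i ≠ 0)
  set i := 2 ^ h * o with hi_def
  have hh : h ≤ Nat.clog 2 d := by
    have h1 : 2 ^ h ≤ 2 ^ Nat.clog 2 d :=
      calc 2 ^ h ≤ 2 ^ h * o := Nat.le_mul_of_pos_right _ ho.pos
        _ ≤ d := hid
        _ ≤ _ := Nat.le_pow_clog (by norm_num) d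
    exact (Nat.pow_le_pow_iff_right (by norm_num)).mp h1
  have hhd : h * d ≤ d * Nat.clog 2 d := by rw [mul_comm]; exact Nat.mul_le_mul_left _ hh
  rw [autoCyclicLength] at hl
  have hget : ∀ t < u.length, (List.replicate i false ++ u.take (u.length - i))[t]? =
      if t < i then some false else u[t - i]? := by
    intro t ht
    rw [List.getElem?_append, List.length_replicate]
    split_ifs with h
    · simp [h]
    · rw [List.getElem?_take, if_pos (by omega)]
  have hsub : (range i) ∪ (Finset.Ico (d + h * d + i) (d + h * d + d)) ⊆
      {t ∈ range u.length | u[t]? ≠ (List.replicate i false ++ u.take (u.length - i))[t]?} := by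
    intro t ht
    rw [Finset.mem_union, Finset.mem_range, Finset.mem_Ico] at ht
    have htl : t < u.length := by omega
    rw [Finset.mem_filter, Finset.mem_range, hget t htl]
    refine ⟨htl, ?_⟩
    rcases ht with ht | ht
    · rw [if_pos ht, getElem?_autoCyclicVector_of_lt (by omega)]
      simp
    · rw [if_neg (by omega)]
      obtain ⟨x, rfl⟩ : ∃ x, t = d + h * d + (x + i) := ⟨t - (d + h * d) - i, by omega⟩
      rw [show d + h * d + (x + i) - i = d + h * d + x by omega,
        getElem?_autoCyclicVector hh (by omega), getElem?_autoCyclicVector hh (by omega), hi_def,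
        Nat.add_mul_div_left _ _ (by positivity)]
      obtain ⟨y, rfl⟩ := ho
      simp only [ne_eq, Option.some.injEq, decide_eq_decide]
      omega
  refine le_trans ?_ (card_le_card hsub)
  rw [card_union_of_disjoint, Finset.card_range, Nat.card_Ico]
  · omega
  · rw [Finset.disjoint_left]
    intro t ht ht'
    rw [Finset.mem_range] at ht
    rw [Finset.mem_Ico] at ht'
    omega

/-! ### Words built from symbols -/

section SymbolWord

variable {F : Type*} {d m nR kR : ℕ}

/-- The binary word `φ(c[0]) ⋯ φ(c[kR-1]) 1^d φ(c[kR]) ⋯ 1^d φ(c[nR-1])`. -/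
def symbolWord (d kR : ℕ) (φ : F → Fin m → Bool) (c : Fin nR → F) : List Bool :=
  (List.ofFn (fun j : Fin nR =>
    (if kR ≤ (j : ℕ) then List.replicate d true else []) ++ List.ofFn (φ (c j)))).flatten

/-- The position in `symbolWord` at which the `j`-th symbol starts. -/
def symbolPos (d m kR j : ℕ) : ℕ := m * j + d * (j + 1 - kR)

lemma symbolPos_add_le {j j' : ℕ} (h : j < j') :
    symbolPos d m kR j + m ≤ symbolPos d m kR j' := by
  rw [symbolPos, symbolPos]
  have h1 : m * (j + 1) ≤ m * j' := Nat.mul_le_mul_left _ h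
  have h2 : d * (j + 1 - kR) ≤ d * (j' + 1 - kR) := Nat.mul_le_mul_left _ (by omega)
  rw [mul_add] at h1
  omega

lemma symbolPos_add_le_length {j : ℕ} (h : j < nR) :
    symbolPos d m kR j + m ≤ m * nR + d * (nR - kR) := by
  rw [symbolPos]
  have h1 : m * (j + 1) ≤ m * nR := Nat.mul_le_mul_left _ h
  have h2 : d * (j + 1 - kR) ≤ d * (nR - kR) := Nat.mul_le_mul_left _ (by omega)
  rw [mul_add] at h1
  omega

variable (φ : F → Fin m → Bool) (c : Fin nR → F)

lemma sum_take_length_symbolWord {j : ℕ} (hj : j ≤ nR) :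
    (((List.ofFn (fun j : Fin nR =>
      (if kR ≤ (j : ℕ) then List.replicate d true else []) ++ List.ofFn (φ (c j)))).map
        List.length).take j).sum = m * j + d * (j - kR) := by
  induction j with
  | zero => simp
  | succ j ih =>
    rw [List.sum_take_succ _ _ (by simpa using hj), ih (by omega)]
    simp only [List.getElem_map, List.getElem_ofFn, List.length_append, List.length_ofFn]
    split_ifs with h
    · rw [List.length_replicate, show j + 1 - kR = j - kR + 1 by omega]
      ring
    · rw [List.length_nil, show j + 1 - kR = 0 by omega, show j - kR = 0 by omega]
      ring

lemma length_symbolWord :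
    (symbolWord d kR φ c).length = m * nR + d * (nR - kR) := by
  rw [symbolWord, List.length_flatten, ← sum_take_length_symbolWord φ c le_rfl,
    List.take_of_length_le (by simp)]

lemma getElem?_symbolWord_symbolPos (j : Fin nR) (t : Fin m) :
    (symbolWord d kR φ c)[symbolPos d m kR j + t]? = some (φ (c j) t) := by
  have h := getElem?_flatten_add (List.ofFn (fun j : Fin nR =>
      (if kR ≤ (j : ℕ) then List.replicate d true else []) ++ List.ofFn (φ (c j)))) j
      ((if kR ≤ (j : ℕ) then d else 0) + t) (by simp) (by
        simp only [List.getElem_ofFn, List.length_append, List.length_ofFn]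
        split_ifs <;> simp)
  rw [sum_take_length_symbolWord φ c j.2.le] at h
  rw [symbolWord]
  convert h using 2
  · rw [symbolPos]
    split_ifs with hk
    · rw [show (j : ℕ) + 1 - kR = j - kR + 1 by omega]
      ring
    · rw [show (j : ℕ) + 1 - kR = 0 by omega, show (j : ℕ) - kR = 0 by omega]
      ring
  · simp only [List.getElem_ofFn]
    split_ifs with hk
    · rw [List.getElem?_append_right (by simp)]
      simp
    · simp

lemma getElem?_symbolWord_marker {j : ℕ} (hj : j < nR) (hk : kR ≤ j) {t : ℕ} (ht : t < d) :
    (symbolWord d kR φ c)[m * j + d * (j - kR) + t]? = some true := by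
  have h := getElem?_flatten_add (List.ofFn (fun j : Fin nR =>
      (if kR ≤ (j : ℕ) then List.replicate d true else []) ++ List.ofFn (φ (c j)))) j t
      (by simpa) (by simp [hk]; omega)
  rw [sum_take_length_symbolWord φ c hj.le] at h
  rw [symbolWord, h]
  simp only [List.getElem_ofFn]
  rw [if_pos hk, List.getElem?_append_left (by simpa)]
  simp [ht]

lemma le_card_of_heavy {a : Fin m → Bool} (ha : d ≤ wordWeight (List.ofFn a)) {k b e : ℕ}
    {X : ℕ → Option Bool} (heb : e ≤ b) (hbe : b + m ≤ e + k)
    (hX : ∀ t : Fin m, X (b + t) = some (a t)) :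
    d ≤ #{t ∈ range k | X (e + t) = some true} := by
  rw [wordWeight_eq_card, List.length_ofFn] at ha
  refine ha.trans (card_filter_range_le_of_offset (a := b - e) (by omega) fun t ht h => ?_)
  rw [show e + (b - e + t) = b + t by omega, hX ⟨t, ht⟩]
  simpa [ht] using h

lemma le_card_mixed_symbolWord {φ : F → Fin m → Bool} {c₀ c₁ : Fin nR → F}
    (h₀ : ∀ j : Fin nR, (j : ℕ) < kR → d ≤ wordWeight (List.ofFn (φ (c₀ j))))
    (h₁ : ∀ j : Fin nR, (j : ℕ) < kR → d ≤ wordWeight (List.ofFn (φ (c₁ j))))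
    (hd : 0 < d) (hm : 2 * d ≤ m) (hR : kR < nR) {k r e : ℕ} (hk : 3 * m ≤ k)
    (he : e + k ≤ m * nR + d * (nR - kR)) :
    d ≤ #{t ∈ range k | (if e + t < r then (symbolWord d kR φ c₁)[e + t]? else
      (symbolWord d kR φ c₀)[e + t]?) = some true} := by
  set X : ℕ → Option Bool := fun x => if x < r then (symbolWord d kR φ c₁)[x]? else
      (symbolWord d kR φ c₀)[x]? with hX
  change d ≤ #{t ∈ range k | X (e + t) = some true}
  have block : ∀ j < kR, e ≤ m * j → m * j + m ≤ e + k → (r ≤ m * j ∨ m * j + m ≤ r) →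
      d ≤ #{t ∈ range k | X (e + t) = some true} := by
    intro j hj hej hje hpure
    have hpos : m * j = symbolPos d m kR (⟨j, by omega⟩ : Fin nR) := by
      simp [symbolPos, show j + 1 - kR = 0 by omega]
    rcases hpure with h | h
    · refine le_card_of_heavy (h₀ ⟨j, by omega⟩ hj) hej hje fun t => ?_
      rw [← getElem?_symbolWord_symbolPos, ← hpos, hX]
      beta_reduce
      rw [if_neg (by omega)]
    · refine le_card_of_heavy (h₁ ⟨j, by omega⟩ hj) hej hje fun t => ?_
      rw [← getElem?_symbolWord_symbolPos, ← hpos, hX]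
      beta_reduce
      rw [if_pos (by omega)]
  have ones : ∀ j < nR, kR ≤ j → e ≤ m * j + d * (j - kR) →
      m * j + d * (j - kR) + d ≤ e + k → d ≤ #{t ∈ range k | X (e + t) = some true} := by
    intro j hj hkj hej hje
    refine le_card_filter_range (a := m * j + d * (j - kR) - e) (by omega) fun t ht => ?_
    rw [show e + (m * j + d * (j - kR) - e + t) = m * j + d * (j - kR) + t by omega, hX]
    beta_reduce
    rw [getElem?_symbolWord_marker _ _ hj hkj ht, getElem?_symbolWord_marker _ _ hj hkj ht,
      ite_self]
  -- `q` is the first symbol starting at or after `e`. Symbols `q` and `q + 1` both fit into `3 * m`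
  -- bits and lie in the prefix, and the cut is interior to at most one of them.
  rcases le_or_gt (e + 2 * m) (m * kR) with h | h
  · obtain ⟨q, hq1, hq2⟩ : ∃ q, e ≤ m * q ∧ m * q < e + m := by
      refine ⟨(e + m - 1) / m, ?_, ?_⟩
      · have := Nat.lt_mul_div_succ (e + m - 1) (by omega : 0 < m)
        rw [mul_add] at this
        omega
      · have := Nat.mul_div_le (e + m - 1) m
        omega
    have hqk : q + 1 < kR := by
      by_contra hcon
      have := Nat.mul_le_mul_left m (not_lt.mp hcon)
      rw [mul_add] at this
      omega
    by_cases hp : r ≤ m * q ∨ m * q + m ≤ r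
    · exact block q (by omega) hq1 (by omega) hp
    · have h1 : m * (q + 1) = m * q + m := by ring
      exact block (q + 1) hqk (by omega) (by omega) (by omega)
  -- Near or beyond the end of the prefix a complete `1^d` is used. It occupies the same positions
  -- in both words, so the cut is harmless.
  rcases le_or_gt e (m * kR) with h2 | h2
  · exact ones kR hR le_rfl (by simpa using h2) (by simp; omega)
  · obtain ⟨y, rfl⟩ : ∃ y, e = m * kR + y := ⟨e - m * kR, by omega⟩
    obtain ⟨q, hq1, hq2⟩ : ∃ q, y ≤ (m + d) * q ∧ (m + d) * q < y + (m + d) := by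
      refine ⟨(y + (m + d) - 1) / (m + d), ?_, ?_⟩
      · have := Nat.lt_mul_div_succ (y + (m + d) - 1) (by omega : 0 < m + d)
        rw [mul_add] at this
        omega
      · have := Nat.mul_div_le (y + (m + d) - 1) (m + d)
        omega
    have hq : m * (kR + q) + d * (kR + q - kR) = m * kR + (m + d) * q := by
      rw [Nat.add_sub_cancel_left]; ring
    have hqn : kR + q < nR := by
      by_contra hcon
      have h3 := Nat.mul_le_mul_left m (not_lt.mp hcon)
      have h4 := Nat.mul_le_mul_left d (show nR - kR ≤ kR + q - kR by omega)
      omega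
    exact ones (kR + q) hqn (by omega) (by omega) (by omega)

lemma isWWL_mixed_symbolWord {φ : F → Fin m → Bool} {c₀ c₁ : Fin nR → F}
    (h₀ : ∀ j : Fin nR, (j : ℕ) < kR → d ≤ wordWeight (List.ofFn (φ (c₀ j))))
    (h₁ : ∀ j : Fin nR, (j : ℕ) < kR → d ≤ wordWeight (List.ofFn (φ (c₁ j))))
    (hd : 0 < d) (hm : 2 * d ≤ m) (hR : kR < nR) {k r : ℕ} (hk : 3 * m ≤ k)
    (hkn : k < m * nR + d * (nR - kR)) (hr : r < m * nR + d * (nR - kR)) :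
    IsWWL d k ((symbolWord d kR φ c₁).take r ++ (symbolWord d kR φ c₀).drop r) := by
  have hl : ((symbolWord d kR φ c₁).take r ++ (symbolWord d kR φ c₀).drop r).length =
      m * nR + d * (nR - kR) := by
    simp [length_symbolWord]; omega
  refine ⟨hd, by omega, by rwa [hl], fun e he => ?_⟩
  rw [wordWeight_window he]
  refine (le_card_mixed_symbolWord h₀ h₁ hd hm hR (r := r) hk (hl ▸ he)).trans_eq ?_
  congr 1
  refine filter_congr fun t _ => ?_
  rw [List.getElem?_append, List.length_take, length_symbolWord, min_eq_left hr.le]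
  split_ifs with h
  · rw [List.getElem?_take, if_pos h]
  · rw [List.getElem?_drop, Nat.add_sub_cancel' (by omega)]

variable [DecidableEq F]

lemma card_symbols_le_card_mixed {φ : F → Fin m → Bool} (hφ : Function.Injective φ)
    (c₀ c₁ e₀ e₁ : Fin nR → F) {r t₀ : ℕ}
    (hlt : ∀ j < t₀, symbolPos d m kR j + m ≤ r) (hgt : ∀ j, t₀ < j → r ≤ symbolPos d m kR j) :
    #{j : Fin nR | ((j : ℕ) < t₀ ∧ c₁ j ≠ e₁ j) ∨ (t₀ < (j : ℕ) ∧ c₀ j ≠ e₀ j)} ≤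
      #{x ∈ range (m * nR + d * (nR - kR)) |
        (if x < r then (symbolWord d kR φ c₁)[x]? else (symbolWord d kR φ c₀)[x]?) ≠
        (if x < r then (symbolWord d kR φ e₁)[x]? else (symbolWord d kR φ e₀)[x]?)} := by
  have key : ∀ j : Fin nR, ((j : ℕ) < t₀ ∧ c₁ j ≠ e₁ j) ∨ (t₀ < (j : ℕ) ∧ c₀ j ≠ e₀ j) →
      ∃ t : Fin m, (if symbolPos d m kR j + t < r then
          (symbolWord d kR φ c₁)[symbolPos d m kR j + t]? else
          (symbolWord d kR φ c₀)[symbolPos d m kR j + t]?) ≠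
        (if symbolPos d m kR j + t < r then
          (symbolWord d kR φ e₁)[symbolPos d m kR j + t]? else
          (symbolWord d kR φ e₀)[symbolPos d m kR j + t]?) := by
    intro j hj
    simp only [getElem?_symbolWord_symbolPos]
    rcases hj with ⟨hj, hne⟩ | ⟨hj, hne⟩
    · obtain ⟨t, ht⟩ := Function.ne_iff.mp (hφ.ne hne)
      refine ⟨t, ?_⟩
      have := hlt j hj
      rw [if_pos (by omega), if_pos (by omega)]
      simpa using ht
    · obtain ⟨t, ht⟩ := Function.ne_iff.mp (hφ.ne hne)
      refine ⟨t, ?_⟩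
      have := hgt j hj
      rw [if_neg (by omega), if_neg (by omega)]
      simpa using ht
  -- `choose!` needs a default bit position, hence the separate case of empty symbols.
  rcases Nat.eq_zero_or_pos m with rfl | hm
  · rw [Finset.card_eq_zero.mpr]
    · exact Nat.zero_le _
    · rw [Finset.filter_eq_empty_iff]
      exact fun j _ hj => (key j hj).choose.elim0
  have : Nonempty (Fin m) := ⟨⟨0, hm⟩⟩
  choose! t ht using key
  refine card_le_card_of_injOn (fun j => symbolPos d m kR j + t j) ?_ ?_
  · intro j hj
    simp only [Finset.coe_filter, Finset.mem_univ, true_and, Set.mem_ofPred_eq] at hj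
    simp only [Finset.coe_filter, Finset.mem_range, Set.mem_ofPred_eq]
    refine ⟨?_, ht j hj⟩
    have := symbolPos_add_le_length (d := d) (m := m) (kR := kR) j.2
    have := (t j).2
    omega
  · intro j _ j' _ hjj
    have h1 := (t j).2
    have h2 := (t j').2
    beta_reduce at hjj
    rcases lt_trichotomy (j : ℕ) j' with h | h | h
    · have := symbolPos_add_le (d := d) (m := m) (kR := kR) h
      omega
    · exact Fin.ext h
    · have := symbolPos_add_le (d := d) (m := m) (kR := kR) h
      omega

/-- `t₀` is the first symbol not lying entirely before the cut, the only one the cut may split; it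
is discarded in the count. -/
lemma exists_symbol_threshold (hm : 0 < m) (r : ℕ) :
    ∃ t₀, (∀ j < t₀, symbolPos d m kR j + m ≤ r) ∧ ∀ j, t₀ < j → r ≤ symbolPos d m kR j := by
  have hex : ∃ j, ¬ symbolPos d m kR j + m ≤ r := by
    refine ⟨r, ?_⟩
    have := Nat.le_mul_of_pos_left r hm
    rw [symbolPos]
    omega
  refine ⟨Nat.find hex, fun j hj => not_not.mp (Nat.find_min hex hj), fun j hj => ?_⟩
  have h1 := Nat.find_spec hex
  have h2 := symbolPos_add_le (d := d) (m := m) (kR := kR) hj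
  omega

lemma card_fin_le_of_forall {n : ℕ} {S : Finset (Fin n)} {T : Finset ℕ}
    (h : ∀ j ∈ S, (j : ℕ) ∈ T) : #S ≤ #T :=
  card_le_card_of_injOn Fin.val h (Fin.val_injective.injOn)

lemma le_card_mixed_symbols (hR : nR = kR + (2 * d + 2)) (hd : 0 < d) {c₀ c₁ e₀ e₁ : Fin nR → F}
    (h₀ : 2 * d + 3 ≤ #{j | c₀ j ≠ e₀ j}) (h₁ : 2 * d + 3 ≤ #{j | c₁ j ≠ e₁ j})
    (hc : #{j : Fin nR | (j : ℕ) < kR ∧ c₀ j ≠ c₁ j} ≤ 1)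
    (he : #{j : Fin nR | (j : ℕ) < kR ∧ e₀ j ≠ e₁ j} ≤ 1) (t₀ : ℕ) :
    d ≤ #{j : Fin nR | ((j : ℕ) < t₀ ∧ c₁ j ≠ e₁ j) ∨ (t₀ < (j : ℕ) ∧ c₀ j ≠ e₀ j)} := by
  set J : Finset (Fin nR) :=
    {j : Fin nR | ((j : ℕ) < t₀ ∧ c₁ j ≠ e₁ j) ∨ (t₀ < (j : ℕ) ∧ c₀ j ≠ e₀ j)} with hJ
  rcases lt_or_ge t₀ (kR + d) with h | h
  -- Early cut: compare with `c₀`, `e₀`. What can be lost is one prefix symbol for each Gray step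
  -- (`A`, `B`), and the symbol `t₀` together with the check symbols up to it, at most `d` in all.
  -- At least `2d + 3 - 2 - d` survive.
  · set K : Finset (Fin nR) := {j : Fin nR | (kR ≤ (j : ℕ) ∧ (j : ℕ) ≤ t₀) ∨ (j : ℕ) = t₀} with hK
    have hKc : #K ≤ d := by
      refine (card_fin_le_of_forall (T := Finset.Icc (min kR t₀) t₀) fun j hj => ?_).trans ?_
      · simp only [hK, Finset.mem_filter, Finset.mem_univ, true_and] at hj
        rw [Finset.mem_Icc]
        omega
      · rw [Nat.card_Icc]
        omega
    set A : Finset (Fin nR) := {j : Fin nR | (j : ℕ) < kR ∧ c₀ j ≠ c₁ j} with hA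
    set B : Finset (Fin nR) := {j : Fin nR | (j : ℕ) < kR ∧ e₀ j ≠ e₁ j} with hB
    have hsub : ({j | c₀ j ≠ e₀ j} : Finset (Fin nR)) ⊆ ((J ∪ A) ∪ B) ∪ K := by
      intro j hj
      simp only [hJ, hK, hA, hB, Finset.mem_filter, Finset.mem_univ, true_and,
        Finset.mem_union] at hj ⊢
      grind
    have h1 := (card_le_card hsub).trans (card_union_le _ _)
    have h2 := card_union_le (J ∪ A) B
    have h3 := card_union_le J A
    omega
  -- Late cut: compare with `c₁`, `e₁`; only the symbols from `t₀` on, at most `d + 2`, are lost.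
  · set K : Finset (Fin nR) := {j : Fin nR | t₀ ≤ (j : ℕ)} with hK
    have hKc : #K ≤ nR - t₀ := by
      refine (card_fin_le_of_forall (T := Finset.Ico t₀ nR) fun j hj => ?_).trans ?_
      · simp only [hK, Finset.mem_filter, Finset.mem_univ, true_and] at hj
        rw [Finset.mem_Ico]
        exact ⟨hj, j.2⟩
      · rw [Nat.card_Ico]
    have hsub : ({j | c₁ j ≠ e₁ j} : Finset (Fin nR)) ⊆ J ∪ K := by
      intro j hj
      simp only [hJ, hK, Finset.mem_filter, Finset.mem_univ, true_and, Finset.mem_union] at hj ⊢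
      grind
    have h1 := (card_le_card hsub).trans (card_union_le _ _)
    omega

lemma le_card_mixed_symbolWord_ne {φ : F → Fin m → Bool} (hφ : Function.Injective φ) (hm : 0 < m)
    (hR : nR = kR + (2 * d + 2)) (hd : 0 < d) {c₀ c₁ e₀ e₁ : Fin nR → F}
    (h₀ : 2 * d + 3 ≤ #{j | c₀ j ≠ e₀ j}) (h₁ : 2 * d + 3 ≤ #{j | c₁ j ≠ e₁ j})
    (hc : #{j : Fin nR | (j : ℕ) < kR ∧ c₀ j ≠ c₁ j} ≤ 1)
    (he : #{j : Fin nR | (j : ℕ) < kR ∧ e₀ j ≠ e₁ j} ≤ 1) (r : ℕ) :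
    d ≤ #{x ∈ range (m * nR + d * (nR - kR)) |
        (if x < r then (symbolWord d kR φ c₁)[x]? else (symbolWord d kR φ c₀)[x]?) ≠
        (if x < r then (symbolWord d kR φ e₁)[x]? else (symbolWord d kR φ e₀)[x]?)} := by
  obtain ⟨t₀, hlt, hgt⟩ := exists_symbol_threshold (d := d) (kR := kR) hm r
  exact (le_card_mixed_symbols hR hd h₀ h₁ hc he t₀).trans
    (card_symbols_le_card_mixed hφ c₀ c₁ e₀ e₁ hlt hgt)

end SymbolWord

/-! ### Reed–Solomon codewords -/

section ReedSolomon

variable {F : Type*} [Field F] {nR kR : ℕ}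

lemma rsEncode_castLE (h : kR ≤ nR) (pts : Fin nR ↪ F) (σ : Fin kR → F) (t : Fin kR) :
    rsEncode h pts σ (Fin.castLE h t) = σ t := by
  rw [rsEncode]
  exact Lagrange.eval_interpolate_at_node σ
    (pts.injective.comp (Fin.castLE_injective h)).injOn (Finset.mem_univ t)

/-- Two polynomials of degree below `kR` that agree at `kR` points coincide. -/
lemma lt_add_card_rsEncode_ne [DecidableEq F] (h : kR ≤ nR) (pts : Fin nR ↪ F)
    {σ τ : Fin kR → F} (hne : σ ≠ τ) :
    nR < kR + #{j | rsEncode h pts σ j ≠ rsEncode h pts τ j} := by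
  by_contra hcon
  have hinj : Set.InjOn (fun i : Fin kR => pts (Fin.castLE h i)) (univ : Finset (Fin kR)) :=
    (pts.injective.comp (Fin.castLE_injective h)).injOn
  have hsum := card_filter_add_card_filter_not (s := (univ : Finset (Fin nR)))
    (fun j => rsEncode h pts σ j = rsEncode h pts τ j)
  rw [Finset.card_univ, Fintype.card_fin] at hsum
  have hk : kR ≤ #{j | rsEncode h pts σ j = rsEncode h pts τ j} := by
    simp only [ne_eq] at hcon
    omega
  have hdeg : ∀ ρ : Fin kR → F, (Lagrange.interpolate Finset.univ
      (fun i : Fin kR => pts (Fin.castLE h i)) ρ).degree <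
      (#{j | rsEncode h pts σ j = rsEncode h pts τ j} : ℕ) := fun ρ =>
    (Lagrange.degree_interpolate_lt ρ hinj).trans_le
      (by rw [Finset.card_univ, Fintype.card_fin]; exact_mod_cast hk)
  have heq := Polynomial.eq_of_degrees_lt_of_eval_index_eq _ pts.injective.injOn
    (hdeg σ) (hdeg τ) (fun j hj => (Finset.mem_filter.mp hj).2)
  refine hne (funext fun t => ?_)
  rw [← rsEncode_castLE h pts σ t, ← rsEncode_castLE h pts τ t, rsEncode, rsEncode, heq]

end ReedSolomon

/-! ### Admissibility of the explicit family -/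

namespace GrayRSData

variable {d n m k : ℕ} (D : GrayRSData d n m k)

lemma codeword_of_lt (i : Fin (heavyCount d m ^ D.kR)) (j : Fin D.nR) (hj : (j : ℕ) < D.kR) :
    D.codeword i j = D.gray i ⟨j, hj⟩ :=
  rsEncode_castLE (D.nR_eq ▸ Nat.le_add_right _ _) D.pts _ ⟨j, hj⟩

lemma word_eq (i : Fin (heavyCount d m ^ D.kR)) :
    D.word i = symbolWord d D.kR D.φ (D.codeword i) := rfl

lemma heavy_codeword (i : Fin (heavyCount d m ^ D.kR)) (j : Fin D.nR) (hj : (j : ℕ) < D.kR) :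
    d ≤ wordWeight (List.ofFn (D.φ (D.codeword i j))) := by
  rw [D.codeword_of_lt i j hj]
  exact (D.gray i ⟨j, hj⟩).2

lemma le_card_codeword_ne [DecidableEq (GaloisField 2 m)] {a b : Fin (heavyCount d m ^ D.kR)}
    (hab : a ≠ b) : 2 * d + 3 ≤ #{j | D.codeword a j ≠ D.codeword b j} := by
  have h := lt_add_card_rsEncode_ne (D.nR_eq ▸ Nat.le_add_right _ _) D.pts
    (σ := fun t => (D.gray a t : GaloisField 2 m)) (τ := fun t => D.gray b t) (fun heq =>
      hab (D.isGrayCode.bijective.1 (funext fun t => Subtype.ext (congrFun heq t))))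
  have h2 := D.nR_eq
  change D.nR < D.kR + #{j | D.codeword a j ≠ D.codeword b j} at h
  omega

lemma card_codeword_ne_succ_le [DecidableEq (GaloisField 2 m)] {a : ℕ}
    (ha : a + 1 < heavyCount d m ^ D.kR) :
    #{j : Fin D.nR | (j : ℕ) < D.kR ∧
      D.codeword ⟨a, Nat.lt_of_succ_lt ha⟩ j ≠ D.codeword ⟨a + 1, ha⟩ j} ≤ 1 := by
  obtain ⟨t, -, ht⟩ := D.isGrayCode.adjacent a ha
  rw [Finset.card_le_one]
  have key : ∀ j : Fin D.nR, (j : ℕ) < D.kR →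
      D.codeword ⟨a, Nat.lt_of_succ_lt ha⟩ j ≠ D.codeword ⟨a + 1, ha⟩ j → (j : ℕ) = t := by
    intro j hj hne
    rw [D.codeword_of_lt _ j hj, D.codeword_of_lt _ j hj] at hne
    exact congrArg Fin.val (ht ⟨j, hj⟩ (fun h => hne (congrArg Subtype.val h)))
  intro x hx y hy
  rw [Finset.mem_filter] at hx hy
  exact Fin.ext ((key x hx.2.1 hx.2.2).trans (key y hy.2.1 hy.2.2).symm)

lemma length_word (i : Fin (heavyCount d m ^ D.kR)) :
    (D.word i).length = m * D.nR + d * (D.nR - D.kR) := by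
  rw [word_eq, length_symbolWord]

lemma sub_eq : n - (k + autoCyclicLength d) = m * D.nR + d * (D.nR - D.kR) := by
  have h1 := D.n_eq
  have h2 := D.nR_eq
  rw [show D.nR - D.kR = 2 * d + 2 by omega, mul_comm d]
  omega

lemma isMRPS (hd : 0 < d) :
    IsMRPS (m * D.nR + d * (D.nR - D.kR)) d (List.ofFn D.word).flatten := by
  classical
  have hm := D.m_pos
  have hR := D.nR_eq
  set N := m * D.nR + d * (D.nR - D.kR) with hN
  have hN0 : 0 < N := by
    have : 0 < m * D.nR := Nat.mul_pos hm (by omega)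
    omega
  intro i j hij hmod hj
  rw [wordDist_window_cyclicPos hij.le hj]
  rw [length_flatten_ofFn (n := N) _ D.length_word] at hj
  obtain ⟨a, r, hr, rfl⟩ : ∃ a r, r < N ∧ i = a * N + r :=
    ⟨i / N, i % N, Nat.mod_lt _ hN0, by rw [mul_comm, Nat.div_add_mod]⟩
  obtain ⟨b, r₂, hr₂, rfl⟩ : ∃ a r, r < N ∧ j = a * N + r :=
    ⟨j / N, j % N, Nat.mod_lt _ hN0, by rw [mul_comm, Nat.div_add_mod]⟩
  rw [Nat.ModEq, Nat.mul_add_mod_of_lt hr, Nat.mul_add_mod_of_lt hr₂] at hmod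
  subst hmod
  have hi : a * N + r + N ≤ heavyCount d m ^ D.kR * N := by omega
  have hab : a < b := by
    by_contra hcon
    have := Nat.mul_le_mul_right N (not_lt.mp hcon)
    omega
  obtain ⟨ha, har⟩ := lt_of_add_le_mul hN0 hi
  obtain ⟨hb, hbr⟩ := lt_of_add_le_mul hN0 hj
  have hget : ∀ c < N, ∀ a, a * N + r + N ≤ heavyCount d m ^ D.kR * N →
      (List.ofFn D.word).flatten[cyclicPos N (a * N + r) c]? = mixedGet D.word a r c :=
    fun c hc a h => getElem?_flatten_cyclicPos _ D.length_word a r c hr h hc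
  suffices h : d ≤ #{c ∈ range N | mixedGet D.word a r c ≠ mixedGet D.word b r c} by
    refine h.trans_eq ?_
    congr 1
    refine filter_congr fun c hc => ?_
    rw [Finset.mem_range] at hc
    rw [cyclicPos_congr (x := c + _) (y := c), hget c hc a hi, hget c hc b hj]
    rw [Nat.add_sub_add_right, ← Nat.sub_mul]
    simp [Nat.ModEq]
  have hne₀ : (⟨a, ha⟩ : Fin (heavyCount d m ^ D.kR)) ≠ ⟨b, hb⟩ := by simp [hab.ne]
  -- With cut `0` the next codeword may not exist, so each codeword is mixed with itself.
  rcases Nat.eq_zero_or_pos r with rfl | hr0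
  · refine (le_card_mixed_symbolWord_ne D.φ.injective hm hR hd (D.le_card_codeword_ne hne₀)
      (D.le_card_codeword_ne hne₀) (by simp) (by simp) 0).trans_eq ?_
    congr 1
    refine filter_congr fun c _ => ?_
    rw [mixedGet_eq _ a 0 c ha (by simp), mixedGet_eq _ b 0 c hb (by simp)]
    simp [word_eq]
  · have hne₁ : (⟨a + 1, har hr0⟩ : Fin (heavyCount d m ^ D.kR)) ≠ ⟨b + 1, hbr hr0⟩ := by
      simp [hab.ne]
    refine (le_card_mixed_symbolWord_ne D.φ.injective hm hR hd (D.le_card_codeword_ne hne₀)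
      (D.le_card_codeword_ne hne₁) (D.card_codeword_ne_succ_le (har hr0))
      (D.card_codeword_ne_succ_le (hbr hr0)) r).trans_eq ?_
    congr 1
    refine filter_congr fun c _ => ?_
    rw [mixedGet_eq _ a r c ha (fun _ => har hr0), mixedGet_eq _ b r c hb (fun _ => hbr hr0)]
    simp only [word_eq, dite_eq_ite]

lemma isAdmissibleFamily (hd : 0 < d) (hm : 2 * d ≤ m) (hk : 3 * m ≤ k)
    (hkn : k < n - (k + autoCyclicLength d)) :
    IsAdmissibleFamily d k (n - (k + autoCyclicLength d)) D.word := by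
  rw [D.sub_eq] at hkn ⊢
  have hR : D.kR < D.nR := by have := D.nR_eq; omega
  refine ⟨D.length_word, fun i => ?_, fun i hi j hj => ?_, D.isMRPS hd⟩
  · have := isWWL_mixed_symbolWord (D.heavy_codeword i) (D.heavy_codeword i) hd hm hR hk hkn
      (Nat.zero_lt_of_lt hkn)
    simpa [word_eq] using this
  · exact isWWL_mixed_symbolWord (D.heavy_codeword _) (D.heavy_codeword _) hd hm hR hk hkn
      (by omega)

theorem isRPS (hd : 0 < d) (hm : 2 * d ≤ m) (hk : 3 * m ≤ k) (hlk : autoCyclicLength d < k)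
    (hkn : 2 * k + autoCyclicLength d < n) : IsRPS n d D.seq :=
  isRPS_markedConcat_of_prefix_of_suffix hlk (by omega) (length_autoCyclicVector d)
    (isAutoCyclic_autoCyclicVector d) (replicate_prefix_autoCyclicVector d)
    (replicate_suffix_autoCyclicVector d) (D.isAdmissibleFamily hd hm hk (by omega))

lemma length_seq : D.seq.length = heavyCount d m ^ D.kR * n := by
  rw [seq, markedConcat, length_flatten_ofFn (n := n)]
  intro i
  have h1 := D.n_eq
  have h2 := D.nR_eq
  rw [List.length_append, D.length_word, ← D.sub_eq, marker, List.length_append,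
    List.length_replicate, length_autoCyclicVector]
  omega

end GrayRSData

/-! ### Existence of Gray codes and of the data of the construction -/

/-- The index in `σ` that the reflected Gray code uses at position `ρ` of its `q`-th run. -/
def reflectIndex (N q ρ : ℕ) : ℕ := if q % 2 = 0 then ρ else N - 1 - ρ

lemma reflectIndex_lt {N q ρ : ℕ} (h : ρ < N) : reflectIndex N q ρ < N := by
  rw [reflectIndex]; split_ifs <;> omega

/-- Reflected Gray code: the new first symbol is constant on runs of length `r ^ κ`, and the shorter
code is traversed alternately forwards and backwards, so only the first symbol changes between runs.
-/
lemma exists_isGrayCode {A : Type*} [Fintype A] {r κ N : ℕ} (hr : Fintype.card A = r)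
    (hN : N = r ^ κ) : ∃ σ : Fin N → Fin κ → A, IsGrayCode σ := by
  classical
  induction κ generalizing N with
  | zero =>
    rw [pow_zero] at hN
    subst hN
    refine ⟨fun _ => Fin.elim0, ⟨?_, fun i hi => by omega⟩⟩
    rw [Fintype.bijective_iff_injective_and_card]
    exact ⟨fun a b _ => Subsingleton.elim a b, by simp⟩
  | succ κ ih =>
    obtain ⟨N', hN'⟩ : ∃ N', N' = r ^ κ := ⟨_, rfl⟩
    obtain ⟨σ, hσ⟩ := ih hN'
    rw [pow_succ, ← hN'] at hN
    rename' N => L, N' => N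
    subst hN
    -- The alphabet may be empty, so positivity of the run length comes from the existence of an
    -- index.
    have hN0 : ∀ i : ℕ, i < N * r → 0 < N := by
      intro i hi
      rcases Nat.eq_zero_or_pos N with h | h
      · rw [h, zero_mul] at hi
        omega
      · exact h
    have hq : ∀ i : ℕ, i < N * r → i / N < r := by
      intro i hi
      rwa [Nat.div_lt_iff_lt_mul (hN0 i hi), mul_comm]
    let e := (Fintype.equivFinOfCardEq hr).symm
    let τ : Fin (N * r) → Fin (κ + 1) → A := fun i =>
      Fin.cons (e ⟨i / N, hq i i.2⟩)
        (σ ⟨reflectIndex N (i / N) (i % N), reflectIndex_lt (Nat.mod_lt _ (hN0 i i.2))⟩)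
    refine ⟨τ, ⟨?_, fun i hi => ?_⟩⟩
    · rw [Fintype.bijective_iff_injective_and_card]
      refine ⟨fun a b hab => ?_, by simp [hr, hN', pow_succ]⟩
      obtain ⟨h1, h2⟩ := Fin.cons_inj.mp hab
      have h3 := congrArg Fin.val (e.injective h1)
      have h4 := congrArg Fin.val (hσ.bijective.1 h2)
      simp only [reflectIndex] at h3 h4
      rw [h3] at h4
      have ha := Nat.mod_lt a (hN0 a a.2)
      have hb := Nat.mod_lt b (hN0 b b.2)
      have h5 : (a : ℕ) % N = b % N := by split_ifs at h4 <;> omega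
      refine Fin.ext ?_
      rw [← Nat.div_add_mod (a : ℕ) N, ← Nat.div_add_mod (b : ℕ) N, h3, h5]
    · have hpos := hN0 _ hi
      have hmod := Nat.mod_lt i hpos
      have hdm := Nat.div_add_mod i N
      rcases Nat.lt_or_ge (i % N + 1) N with h | h
      · have hdiv : (i + 1) / N = i / N := by
          rw [← hdm, add_assoc, Nat.mul_add_div hpos, Nat.mul_add_div hpos,
            Nat.div_eq_of_lt h, Nat.div_eq_of_lt hmod]
        have hmod' : (i + 1) % N = i % N + 1 := by
          have := Nat.div_add_mod (i + 1) N
          rw [hdiv] at this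
          omega
        have key : ∃! t : Fin κ,
            σ ⟨reflectIndex N (i / N) (i % N), reflectIndex_lt hmod⟩ t ≠
            σ ⟨reflectIndex N (i / N) (i % N + 1), reflectIndex_lt h⟩ t := by
          simp only [reflectIndex]
          split_ifs with hpar
          · exact hσ.adjacent _ h
          · have := hσ.adjacent (N - 1 - (i % N + 1)) (by omega)
            simp only [show N - 1 - (i % N + 1) + 1 = N - 1 - i % N by omega] at this
            obtain ⟨t, ht, huniq⟩ := this
            exact ⟨t, ht.symm, fun y hy => huniq y hy.symm⟩
        obtain ⟨t, ht, huniq⟩ := key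
        refine ⟨t.succ, ?_, fun y => ?_⟩
        · simpa only [τ, Fin.cons_succ, hdiv, hmod'] using ht
        · refine Fin.cases ?_ (fun y hy => ?_) y
          · intro hy
            simp only [τ, Fin.cons_zero, hdiv] at hy
            exact absurd rfl hy
          · simp only [τ, Fin.cons_succ, hdiv, hmod'] at hy
            rw [huniq y hy]
      · have h' : i % N = N - 1 := by omega
        have hi1 : i + 1 = N * (i / N + 1) := by rw [mul_add]; omega
        have hdiv : (i + 1) / N = i / N + 1 := by rw [hi1, Nat.mul_div_cancel_left _ hpos]
        have hmod' : (i + 1) % N = 0 := by rw [hi1, Nat.mul_mod_right]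
        have hidx : reflectIndex N (i / N) (i % N) =
            reflectIndex N ((i + 1) / N) ((i + 1) % N) := by
          rw [hdiv, hmod', h', reflectIndex, reflectIndex]
          split_ifs <;> omega
        refine ⟨0, ?_, fun y => ?_⟩
        · simp only [τ, Fin.cons_zero, ne_eq, EmbeddingLike.apply_eq_iff_eq, Fin.mk.injEq]
          omega
        · refine Fin.cases (fun _ => rfl) (fun y hy => ?_) y
          simp only [τ, Fin.cons_succ, hidx] at hy
          exact absurd rfl hy

lemma card_heavy (d m : ℕ) :
    #{v : Fin m → Bool | d ≤ wordWeight (List.ofFn v)} = heavyCount d m := by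
  have hw : ∀ v : Fin m → Bool, wordWeight (List.ofFn v) = #{i | v i = true} := by
    intro v
    rw [wordWeight_eq_card, List.length_ofFn, card_filter, card_filter, ← Fin.sum_univ_eq_sum_range]
    simp
  have h1 : #{v : Fin m → Bool | d ≤ wordWeight (List.ofFn v)} =
      #{s : Finset (Fin m) | d ≤ #s} := by
    refine Finset.card_nbij' (fun v => ({i | v i = true} : Finset (Fin m)))
      (fun s i => decide (i ∈ s)) ?_ ?_ ?_ ?_
    · intro v hv
      simpa [hw] using hv
    · intro s hs
      simpa [hw] using hs
    · intro v _
      simp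
    · intro s _
      simp
  rw [h1, Finset.card_eq_sum_card_fiberwise (f := Finset.card) (t := Finset.Icc d m), heavyCount]
  · refine Finset.sum_congr rfl fun i hi => ?_
    rw [Finset.mem_Icc] at hi
    have h2 : m.choose i = #(Finset.powersetCard i (univ : Finset (Fin m))) := by simp
    rw [h2]
    congr 1
    ext s
    simp only [Finset.mem_filter, Finset.mem_univ, true_and, Finset.mem_powersetCard,
      Finset.subset_univ]
    omega
  · intro s hs
    have h2 := Finset.card_le_univ s
    rw [Fintype.card_fin] at h2
    rw [Finset.coe_Icc, Set.mem_Icc]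
    exact ⟨(Finset.mem_filter.mp hs).2, h2⟩

theorem nonempty_grayRSData {d n m k kR : ℕ} (hm : 0 < m)
    (hn : n = (k + autoCyclicLength d) + (m * (kR + (2 * d + 2)) + (2 * d + 2) * d))
    (hR : kR + (2 * d + 2) ≤ 2 ^ m) : Nonempty (GrayRSData d n m k) := by
  classical
  have hcard := GaloisField.card 2 m hm.ne'
  have : Finite (GaloisField 2 m) := Nat.finite_of_card_ne_zero (by rw [hcard]; positivity)
  have := Fintype.ofFinite (GaloisField 2 m)
  obtain ⟨φ⟩ := Finite.card_eq.mp (show Nat.card (GaloisField 2 m) = Nat.card (Fin m → Bool) by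
    rw [hcard]; simp)
  obtain ⟨pts⟩ := Function.Embedding.nonempty_of_card_le
    (show Fintype.card (Fin (kR + (2 * d + 2))) ≤ Fintype.card (GaloisField 2 m) by
      rw [← Nat.card_eq_fintype_card (α := GaloisField 2 m), hcard]; simpa)
  have hX : Fintype.card {a : GaloisField 2 m // d ≤ wordWeight (List.ofFn (φ a))} =
      heavyCount d m := by
    rw [← card_heavy, ← Fintype.card_subtype]
    exact Fintype.card_congr (φ.subtypeEquiv fun _ => Iff.rfl)
  obtain ⟨σ, hσ⟩ := exists_isGrayCode (κ := kR) hX rfl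
  exact ⟨⟨hm, _, kR, rfl, hn, φ, pts, σ, hσ⟩⟩

/-! ### Redundancy -/

/-- The complement consists of the words of weight below `d`: `d` binomial coefficients, each at
most `m ^ d`. -/
lemma heavyCount_ge (d m : ℕ) (hdm : d ≤ m) (hm : 0 < m) :
    (2 : ℝ) ^ m - d * m ^ d ≤ heavyCount d m := by
  have h1 : ∑ i ∈ range d, m.choose i + heavyCount d m = 2 ^ m := by
    rw [← Nat.sum_range_choose, heavyCount, ← Finset.Ico_succ_right_eq_Icc,
      ← Finset.sum_range_add_sum_Ico _ (show d ≤ m + 1 by omega)]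
    rfl
  have h2 : ∑ i ∈ range d, m.choose i ≤ d * m ^ d := by
    refine (Finset.sum_le_card_nsmul _ _ (m ^ d) fun i hi => ?_).trans (by simp)
    exact (Nat.choose_le_pow m i).trans (Nat.pow_le_pow_right hm (Finset.mem_range.mp hi).le)
  have h3 : (∑ i ∈ range d, m.choose i : ℕ) + (heavyCount d m : ℝ) = 2 ^ m := by exact_mod_cast h1
  have h4 : ((∑ i ∈ range d, m.choose i : ℕ) : ℝ) ≤ d * m ^ d := by exact_mod_cast h2
  linarith

lemma neg_logb_one_sub_le {ε : ℝ} (h0 : 0 ≤ ε) (h : ε ≤ 1 / 2) :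
    -Real.logb 2 (1 - ε) ≤ 4 * ε := by
  have h1 := Real.one_sub_inv_le_log_of_pos (show 0 < 1 - ε by linarith)
  have h2 : (1 - ε)⁻¹ ≤ 1 + 2 * ε := by
    rw [inv_le_iff_one_le_mul₀ (by linarith)]
    nlinarith
  have h3 := Real.log_two_gt_d9
  rw [Real.logb, ← neg_div, div_le_iff₀ (by linarith)]
  nlinarith

lemma eventually_mul_sub_logb_heavyCount_le (d : ℕ) : ∀ᶠ m : ℕ in atTop,
    0 < heavyCount d m ∧ ∀ n κ : ℕ, 1 ≤ n → κ ≤ n → 5 / 4 * Real.logb 2 n ≤ m →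
      κ * (m - Real.logb 2 (heavyCount d m)) ≤ 1 := by
  have hr0 : (0 : ℝ) ≤ 2 ^ (4 / 5 : ℝ) / 2 := by positivity
  have hr1 : (2 : ℝ) ^ (4 / 5 : ℝ) / 2 < 1 := by
    rw [div_lt_one (by norm_num)]
    calc (2 : ℝ) ^ (4 / 5 : ℝ) < 2 ^ (1 : ℝ) :=
          Real.rpow_lt_rpow_of_exponent_lt (by norm_num) (by norm_num)
      _ = 2 := Real.rpow_one 2
  have hlim := (tendsto_pow_const_mul_const_pow_of_abs_lt_one d
    (by rwa [abs_of_nonneg hr0] : |(2 : ℝ) ^ (4 / 5 : ℝ) / 2| < 1)).const_mul (4 * d : ℝ)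
  rw [mul_zero] at hlim
  have hlim2 := (tendsto_pow_const_div_const_pow_of_one_lt d (one_lt_two (α := ℝ))).const_mul
    (d : ℝ)
  rw [mul_zero] at hlim2
  filter_upwards [hlim.eventually_le_const one_pos,
    hlim2.eventually_le_const (show (0 : ℝ) < 1 / 2 by norm_num), eventually_ge_atTop d,
    eventually_gt_atTop 0] with m h1 h2 hdm hm
  have h2m : (0 : ℝ) < 2 ^ m := by positivity
  set ε : ℝ := d * (m ^ d / 2 ^ m) with hε
  have hε0 : 0 ≤ ε := by positivity
  have hge : (2 : ℝ) ^ m * (1 - ε) ≤ heavyCount d m := by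
    refine le_trans (le_of_eq ?_) (heavyCount_ge d m hdm hm)
    rw [hε]
    field_simp
  have hpos : (0 : ℝ) < 2 ^ m * (1 - ε) := mul_pos h2m (by linarith)
  refine ⟨by exact_mod_cast hpos.trans_le hge, fun n κ hn hκ hnm => ?_⟩
  have hlog : (m : ℝ) - Real.logb 2 (heavyCount d m) ≤ 4 * ε := by
    have h3 := Real.logb_le_logb_of_le one_lt_two hpos hge
    rw [Real.logb_mul h2m.ne' (by linarith), Real.logb_pow, Real.logb_self_eq_one one_lt_two,
      mul_one] at h3
    have := neg_logb_one_sub_le hε0 h2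
    linarith
  -- This is `5/4 * log n ≤ m`; it leaves `2^(-m/5)` to beat the polynomial factor `m ^ d`.
  have hn' : (n : ℝ) ≤ (2 ^ (4 / 5 : ℝ)) ^ m := by
    rw [← Real.rpow_natCast, ← Real.rpow_mul (by norm_num),
      ← Real.logb_le_iff_le_rpow one_lt_two (by positivity)]
    linarith
  calc (κ : ℝ) * (m - Real.logb 2 (heavyCount d m)) ≤ κ * (4 * ε) := by gcongr
    _ ≤ (2 ^ (4 / 5 : ℝ)) ^ m * (4 * ε) := by
      gcongr
      exact le_trans (by exact_mod_cast hκ) hn'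
    _ = 4 * d * (m ^ d * (2 ^ (4 / 5 : ℝ) / 2) ^ m) := by
      rw [hε, div_pow]; ring
    _ ≤ 1 := h1

lemma GrayRSData.redundancy_seq_le {d n m k : ℕ} (D : GrayRSData d n m k) (hn : 0 < n)
    (hr : 0 < heavyCount d m)
    (herr : D.kR * (m - Real.logb 2 (heavyCount d m)) ≤ 1) :
    redundancy n D.seq ≤ k + autoCyclicLength d + m * (2 * d + 2) + (2 * d + 2) * d + 1 -
      Real.logb 2 n := by
  have h1 : (n : ℝ) = (k + autoCyclicLength d) + (m * (D.kR + (2 * d + 2)) + (2 * d + 2) * d) := by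
    have := D.n_eq
    rw [D.nR_eq] at this
    exact_mod_cast this
  rw [redundancy, D.length_seq]
  push_cast
  rw [Real.logb_mul (by positivity) (by positivity), Real.logb_pow]
  linarith

lemma eventually_linear_logb_lt (a b : ℝ) (ha : 0 ≤ a) :
    ∀ᶠ n : ℕ in atTop, a * Real.logb 2 n + b < n := by
  have h1 := (Real.isLittleO_log_id_atTop.bound (show (0 : ℝ) < 1 / (4 * (a + 1)) by positivity))
  have h2 := tendsto_natCast_atTop_atTop (R := ℝ) |>.eventually h1
  filter_upwards [h2, (tendsto_natCast_atTop_atTop (R := ℝ)).eventually_gt_atTop (2 * b),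
    eventually_ge_atTop 1] with n hn hb hn1
  have hn1' : (1 : ℝ) ≤ n := by exact_mod_cast hn1
  have h0 := Real.log_nonneg hn1'
  rw [id, Real.norm_of_nonneg h0, Real.norm_of_nonneg (by linarith), div_mul_eq_mul_div, one_mul,
    le_div_iff₀ (by positivity)] at hn
  have h3 := Real.log_two_gt_d9
  have h4 : Real.logb 2 n ≤ 2 * Real.log n := by
    rw [Real.logb, div_le_iff₀ (by linarith)]
    nlinarith
  have h5 := mul_le_mul_of_nonneg_left h4 ha
  nlinarith

/-- The congruence makes `nR = q` an integer, the size bound gives `kR ≥ 0`, and `n ≤ 2 ^ m` leaves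
enough evaluation points. -/
lemma nonempty_grayRSData_of_modEq {d n m k : ℕ} (hm : 0 < m)
    (hn : k + autoCyclicLength d + (2 * d + 2) * d + m * (2 * d + 2) ≤ n) (hnm : n ≤ 2 ^ m)
    (hmod : n ≡ k + autoCyclicLength d + (2 * d + 2) * d [MOD m]) :
    Nonempty (GrayRSData d n m k) := by
  obtain ⟨q, hq⟩ := (Nat.modEq_iff_dvd' (by omega)).mp hmod.symm
  have hq' : 2 * d + 2 ≤ q := by
    by_contra hcon
    have := Nat.mul_lt_mul_of_pos_left (not_le.mp hcon) hm
    omega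
  have hqm := Nat.le_mul_of_pos_left q hm
  refine nonempty_grayRSData (kR := q - (2 * d + 2)) hm ?_ ?_
  · rw [Nat.sub_add_cancel hq', ← hq]
    omega
  · omega

theorem eventually_grayRSData (d : ℕ) (hd : 1 ≤ d) : ∀ᶠ n : ℕ in atTop,
    0 < Real.logb 2 n ∧ autoCyclicLength d + (2 * d + 2) * d ≤ n ∧
    ∀ m k : ℕ, 5 / 4 * Real.logb 2 n ≤ m → m ≤ 3 / 2 * Real.logb 2 n + 1 → 3 * m ≤ k →
      k < 4 * m →
      (n ≡ k + autoCyclicLength d + (2 * d + 2) * d [MOD m] → Nonempty (GrayRSData d n m k)) ∧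
      ∀ D : GrayRSData d n m k, IsRPS n d D.seq ∧
        redundancy n D.seq ≤ k + autoCyclicLength d + m * (2 * d + 2) + (2 * d + 2) * d + 1 -
          Real.logb 2 n := by
  obtain ⟨m₀, hm₀⟩ := eventually_atTop.mp (eventually_mul_sub_logb_heavyCount_le d)
  have hlog : Tendsto (fun n : ℕ => Real.logb 2 n) atTop atTop :=
    (Real.tendsto_logb_atTop one_lt_two).comp tendsto_natCast_atTop_atTop
  filter_upwards [hlog.eventually_ge_atTop (m₀ + 2 * d + autoCyclicLength d + 1 : ℕ),
    eventually_linear_logb_lt (3 / 2 * (8 + (2 * d + 2)))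
      ((8 + (2 * d + 2)) + (autoCyclicLength d + (2 * d + 2) * d)) (by positivity),
    eventually_ge_atTop 1] with n hL hlin hn
  set L := Real.logb 2 n with hLdef
  have hL0 : 0 < L := lt_of_lt_of_le (by positivity) hL
  refine ⟨hL0, ?_, fun m k hm1 hm2 hk1 hk2 => ?_⟩
  · have : (autoCyclicLength d + (2 * d + 2) * d : ℝ) ≤ n := by nlinarith
    exact_mod_cast this
  have hmL : L ≤ m := by linarith
  have hm : m₀ + 2 * d + autoCyclicLength d + 1 ≤ m := by exact_mod_cast hL.trans hmL
  -- `8 * m` covers `2 * k`, as `k < 4 * m`; the next term covers the check symbols.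
  have hbig : 8 * m + (2 * d + 2) * m + (autoCyclicLength d + (2 * d + 2) * d) < n := by
    have : (8 * m + (2 * d + 2) * m + (autoCyclicLength d + (2 * d + 2) * d) : ℝ) < n := by
      have := mul_le_mul_of_nonneg_left hm2 (show (0 : ℝ) ≤ 8 + (2 * d + 2) by positivity)
      linarith
    exact_mod_cast this
  obtain ⟨hpos, herr⟩ := hm₀ m (by omega)
  refine ⟨fun hmod => nonempty_grayRSData_of_modEq (by omega) ?_ ?_ hmod, fun D => ⟨?_, ?_⟩⟩
  · rw [mul_comm m]
    omega
  · have : (n : ℝ) ≤ 2 ^ m := by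
      rw [← Real.rpow_natCast, ← Real.logb_le_iff_le_rpow one_lt_two (by positivity)]
      exact hmL
    exact_mod_cast this
  · have : 0 ≤ (2 * d + 2) * d := Nat.zero_le _
    exact D.isRPS hd (by omega) hk1 (by omega) (by omega)
  · refine D.redundancy_seq_le hn hpos (herr n D.kR hn ?_ hm1)
    have h1 := D.n_eq
    have h2 := D.nR_eq
    have h3 := Nat.le_mul_of_pos_left D.nR D.m_pos
    omega

end

/-! ### The main theorem -/

theorem mainTheorem1 (d : ℕ) (hd : 1 ≤ d) :
    (∀ (n k M : ℕ) (u : List Bool) (s : Fin M → List Bool),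
      autoCyclicLength d < k → k + autoCyclicLength d < n →
      u.length = autoCyclicLength d → IsAutoCyclic d u →
      List.replicate d true <+: u → List.replicate d true <:+ u →
      IsAdmissibleFamily d k (n - (k + autoCyclicLength d)) s →
      IsRPS n d (markedConcat (marker k u) s)) ∧
    ∃ (C : ℝ) (n₀ : ℕ), ∀ n : ℕ, n₀ ≤ n →
      (∃ m k : ℕ, 3 * m ≤ k ∧ k < 4 * m ∧ Nonempty (GrayRSData d n m k) ∧
        ∀ D : GrayRSData d n m k,
          IsRPS n d D.seq ∧
          redundancy n D.seq ≤ 3 * d * Real.logb 2 n + 6.5 * Real.logb 2 n + C) ∧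
      (∀ m : ℕ, m = ⌈(3 / 2 : ℝ) * Real.logb 2 n⌉₊ →
        (n ≡ autoCyclicLength d + (2 * d + 2) * d [MOD m] →
          Nonempty (GrayRSData d n m (3 * m))) ∧
        ∀ D : GrayRSData d n m (3 * m),
          IsRPS n d D.seq ∧
          redundancy n D.seq ≤ 3 * d * Real.logb 2 n + 6.5 * Real.logb 2 n + C) := by

  refine ⟨fun n k M u s hk hkn hu hac hpre hsuf hs =>
    isRPS_markedConcat_of_prefix_of_suffix hk hkn hu hac hpre hsuf hs, ?_⟩
  obtain ⟨n₀, hn₀⟩ := Filter.eventually_atTop.mp (eventually_grayRSData d hd)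
  -- Rounding `m` up costs at most `2d + 6`, the loss from light symbols at most `1`; the rest is
  -- the part of the length independent of `m`.
  refine ⟨2 * d + 7 + autoCyclicLength d + (2 * d + 2) * d, n₀, fun n hn => ?_⟩
  obtain ⟨hL, hln, H⟩ := hn₀ n hn
  have hd0 : (0 : ℝ) ≤ d := Nat.cast_nonneg d
  have hdL : 0 ≤ d * Real.logb 2 n := mul_nonneg hd0 hL.le
  constructor
  · obtain ⟨m, hm⟩ : ∃ m, m = ⌈(5 / 4 : ℝ) * Real.logb 2 n⌉₊ := ⟨_, rfl⟩
    have hm1 : (5 / 4 : ℝ) * Real.logb 2 n ≤ m := hm ▸ Nat.le_ceil _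
    have hm2 : (m : ℝ) ≤ 5 / 4 * Real.logb 2 n + 1 :=
      hm ▸ (Nat.ceil_lt_add_one (by linarith)).le
    have hm0 : 0 < m := by
      have : (0 : ℝ) < m := by linarith
      exact_mod_cast this
    set x := n - (autoCyclicLength d + (2 * d + 2) * d) with hx
    have hxm := Nat.mod_lt x hm0
    -- The remainder is absorbed into the zeros of the marker, so that `m` divides what is left.
    obtain ⟨hex, hD⟩ := H m (3 * m + x % m) hm1 (by linarith) (by omega) (by omega)
    refine ⟨m, 3 * m + x % m, by omega, by omega, hex ?_, fun D => ⟨(hD D).1, ?_⟩⟩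
    · rw [add_assoc]
      calc n = x + (autoCyclicLength d + (2 * d + 2) * d) := by omega
        _ ≡ 3 * m + x % m + (autoCyclicLength d + (2 * d + 2) * d) [MOD m] :=
          Nat.ModEq.add_right _ (by simp [Nat.ModEq])
    · refine (hD D).2.trans ?_
      have hk : ((3 * m + x % m : ℕ) : ℝ) ≤ 4 * m := by
        exact_mod_cast (show 3 * m + x % m ≤ 4 * m by omega)
      -- Leading coefficient: `(2d + 6) * 5/4 - 1 = 2.5 d + 6.5`.
      have := mul_le_mul_of_nonneg_left hm2 (show (0 : ℝ) ≤ 2 * d + 6 by positivity)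
      linarith
  · intro m hm
    have hm1 : (3 / 2 : ℝ) * Real.logb 2 n ≤ m := hm ▸ Nat.le_ceil _
    have hm2 : (m : ℝ) ≤ 3 / 2 * Real.logb 2 n + 1 :=
      hm ▸ (Nat.ceil_lt_add_one (by linarith)).le
    have hm0 : 0 < m := by
      have : (0 : ℝ) < m := by linarith
      exact_mod_cast this
    obtain ⟨hex, hD⟩ := H m (3 * m) (by linarith) hm2 le_rfl (by omega)
    refine ⟨fun hmod => hex ?_, fun D => ⟨(hD D).1, (hD D).2.trans ?_⟩⟩
    · rw [add_assoc]
      exact hmod.trans (by simp [Nat.ModEq])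
    · push_cast
      -- Leading coefficient: `(2d + 5) * 3/2 - 1 = 3 d + 6.5`, with no slack.
      have := mul_le_mul_of_nonneg_left hm2 (show (0 : ℝ) ≤ 2 * d + 5 by positivity)
      linarith
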